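/- **Setting.** Let $T\ge1$ and $L:=\lceil\log_2T\rceil$. Offline data $(z_i,y_i)_{i\le n}$ satisfy $\|z_i\|_2\le1$, $y_i=z_i^\top\theta^\dagger+\xi_i$, where, given all covariates $z_1,\dots,z_n$ and $y_1,\dots,y_{i-1}$, the noise $\xi_i$ is centred and $\sigma$-sub-Gaussian. In round $t=1,\dots,T$ the learner sees $x_{t,a}\in\mathbb R^d$, $a\in[K]$, with $\|x_{t,a}\|_2\le1$ and mean rewards $x_{t,a}^\top\theta_*\in[0,1]$, plays $a_t$ and receives $r_t=x_{t,a_t}^\top\theta_*+\eta_t\in[0,1]$. There is a filtration $(\mathcal F_{t})$ such that the $z_i$ are $\mathcal F_0$-measurable, the past rewards, the contexts of round $t$, the action $a_t$ and its layer $\ell_t$ (below) are $\mathcal F_{t-1}$-measurable, and $\eta_t$ is centred and $\sigma$-sub-Gaussian given $\mathcal F_{t-1}$. Here $\sigma\ge0$ and $\|\theta_*\|_2,\|\theta^\dagger\|_2\le S$. The pair $M\succ0$, $\rho\ge0$ satisfies $\|\theta_*-\theta^\dagger\|_M\le\rho$, where $\|v\|_M:=\sqrt{v^\top Mv}$. Positive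 budgets $\delta_{\rm off},\delta_{\rm on},\delta^{\rm on}_{t,\ell},\delta^{\rm pool}_{t,\ell}$ ($t\le T$, $0\le\ell\le L$) satisfy $\sum_{t,\ell}\delta^{\rm on}_{t,\ell}\le\delta_{\rm on}$ and $\delta_{\rm off}+\delta_{\rm on}+\sum_{t,\ell}\delta^{\rm pool}_{t,\ell}\le T^{-2}$. The regret is $R_T:=\sum_{t\le T}(\max_ax_{t,a}^\top\theta_*-x_{t,a_t}^\top\theta_*)$. **Algorithm (Ellipsoidal-MINUCB).** Put $G:=I+\sum_iz_iz_i^\top$, $\hat\theta_{\rm off}:=G^{-1}\sum_iz_iy_i$, $\beta_{\rm off}:=\sigma\sqrt{2\log(\det(G)^{1/2}/\delta_{\rm off})}+S$. Each round $t$ is assigned to a layer $\ell_t\in\{0,\dots,L\}$. Let $$A_{t,\ell}:=\sum_{s<t,\ \ell_s=\ell}x_{s,a_s}x_{s,a_s}^\top,\qquad b_{t,\ell}:=\sum_{s<t,\ \ell_s=\ell}x_{s,a_s}r_s,\qquad V_{t,\ell}:=I+A_{t,\ell},$$ $$\beta^{\rm on}_{t,\ell}:=\sigma\sqrt{2\log\frac{\det(V_{t,\ell})^{1/2}}{\delta^{\rm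 on}_{t,\ell}}}+S,\qquad \gamma_{t,\ell}:=\sigma\sqrt{2\log\frac{\det(A_{t,\ell}+G)^{1/2}}{\det(G)^{1/2}\delta^{\rm pool}_{t,\ell}}},\qquad \psi_{t,\ell}(x):=\|M^{-1/2}G(A_{t,\ell}+G)^{-1}x\|_2 .$$ The online interval of action $a$ has centre $x_{t,a}^\top V_{t,\ell}^{-1}b_{t,\ell}$ and radius $\beta^{\rm on}_{t,\ell}\|x_{t,a}\|_{V_{t,\ell}^{-1}}$; the pooled interval has centre $x_{t,a}^\top(A_{t,\ell}+G)^{-1}(b_{t,\ell}+G\hat\theta_{\rm off})$ and radius $(\gamma_{t,\ell}+\beta_{\rm off})\|x_{t,a}\|_{(A_{t,\ell}+G)^{-1}}+\rho\,\psi_{t,\ell}(x_{t,a})$. Let $U_{t,\ell}(a)$ be the smaller of the two upper endpoints, $L_{t,\ell}(a)$ the larger of the two lower endpoints, and $w_{t,\ell}(a):=U_{t,\ell}(a)-L_{t,\ell}(a)$. In round $t$ start with $\mathcal A_{t,0}=[K]$. At layer $\ell<L$, if some $a\in\mathcal A_{t,\ell}$ has $w_{t,\ell}(a)>2^{-\ell}$,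 play a maximizer of $U_{t,\ell}$ among these actions and set $\ell_t=\ell$; otherwise go to layer $\ell+1$ with $\mathcal A_{t,\ell+1}=\{a\in\mathcal A_{t,\ell}:U_{t,\ell}(a)\ge\max_{a'\in\mathcal A_{t,\ell}}L_{t,\ell}(a')\}$. At layer $L$ play a maximizer of $U_{t,L}$ over $\mathcal A_{t,L}$ (any action, if $\mathcal A_{t,L}$ is empty) and set $\ell_t=L$. Ties are broken arbitrarily. **Notation for the bound.** Let $\Lambda_\ell:=\log\bigl(\det(G+\sum_{t\le T:\,\ell_t=\ell}x_{t,a_t}x_{t,a_t}^\top)/\det G\bigr)$, $\widetilde\Lambda_T:=\sum_{\ell=0}^L\Lambda_\ell$, $\Lambda_{\max}:=\max_\ell\Lambda_\ell$, $\widetilde\Psi_T:=\sum_{t\le T}\psi_{t,\ell_t}(x_{t,a_t})$, $\Gamma_{\rm pool}:=\beta_{\rm off}+\sigma\sqrt{\Lambda_{\max}+2\log(1/\min_{t,\ell}\delta^{\rm pool}_{t,\ell})}$, $c_{\rm align}:=\lambda_{\max}(G^{1/2}M^{-1}G^{1/2})$, and $L_T:=\log(2KT\log T/\delta_{\rm on})$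 (read as $0$ if $T=1$). Let $\mathcal E$ be the event that $\|\hat\theta_{\rm off}-\theta^\dagger\|_G\le\beta_{\rm off}$ and, for all $t\le T$ and $0\le\ell\le L$, $$\|b_{t,\ell}-A_{t,\ell}\theta_*\|_{V_{t,\ell}^{-1}}\le\beta^{\rm on}_{t,\ell}-S,\qquad \|b_{t,\ell}-A_{t,\ell}\theta_*\|_{(A_{t,\ell}+G)^{-1}}\le\gamma_{t,\ell}.$$ **Corollary (explicit pooled-better regime).** We have $\mathbb P(\mathcal E)\ge1-T^{-2}$, and on $\mathcal E$ $$R_T\le 8\Gamma_{\rm pool}\sqrt{2T\widetilde\Lambda_T}+8\rho\widetilde\Psi_T\le 8\bigl(\Gamma_{\rm pool}+\rho\sqrt{c_{\rm align}}\bigr)\sqrt{2T\widetilde\Lambda_T}.$$ Consequently, on $\mathcal E$, for every constant $C_{\rm SL}\ge0$: if $$\widetilde\Lambda_T\bigl(\Gamma_{\rm pool}+\rho\sqrt{c_{\rm align}}\bigr)^2\le\frac{C_{\rm SL}^2}{128}\,d\,L_T^3,$$ then the pooled term $8\Gamma_{\rm pool}\sqrt{2T\widetilde\Lambda_T}+8\rho\widetilde\Psi_T$,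 and also its upper bound $8(\Gamma_{\rm pool}+\rho\sqrt{c_{\rm align}})\sqrt{2T\widetilde\Lambda_T}$, is at most the online fallback $C_{\rm SL}\sqrt{T\,d\,L_T^3}$. -/

import Mathlib

open MeasureTheory Matrix

namespace EllipsoidalMinUCB

noncomputable section

/-- Euclidean norm of a vector. -/
def l2norm {d : ℕ} (v : Fin d → ℝ) : ℝ := Real.sqrt (v ⬝ᵥ v)

/-- The norm `‖v‖_M = √(vᵀ M v)` induced by a positive semidefinite matrix. -/
def mnorm {d : ℕ} (M : Matrix (Fin d) (Fin d) ℝ) (v : Fin d → ℝ) : ℝ :=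
  Real.sqrt (v ⬝ᵥ (M *ᵥ v))

/-- The square root of a positive semidefinite matrix (functional calculus). -/
def msqrt {d : ℕ} (M : Matrix (Fin d) (Fin d) ℝ) : Matrix (Fin d) (Fin d) ℝ :=
  cfc Real.sqrt M

/-- The largest eigenvalue of a symmetric real matrix. -/
def lambdaMax {d : ℕ} (M : Matrix (Fin d) (Fin d) ℝ) : ℝ := sSup (spectrum ℝ M)

/-- Inputs of the algorithm (horizon, certificate, confidence budgets) and the constants
`σ` and `S` of the model. Rounds are numbered `0, …, T - 1`; layers `0, …, ⌈log₂ T⌉`. -/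
structure Config (d : ℕ) where
  T : ℕ
  σ : ℝ
  S : ℝ
  M : Matrix (Fin d) (Fin d) ℝ
  ρ : ℝ
  δoff : ℝ
  δon : ℝ
  δonline : ℕ → ℕ → ℝ
  δpool : ℕ → ℕ → ℝ

/-- A realized trajectory: offline samples `(z i, y i)`, contexts `x t a`, played actions `act t`,
rewards `r t`, and stopping layers `layer t`. Only rounds `t < T` matter. -/
structure Trajectory (K d n : ℕ) where
  z : Fin n → Fin d → ℝ
  y : Fin n → ℝ
  x : ℕ → Fin K → Fin d → ℝ
  act : ℕ → Fin K
  r : ℕ → ℝ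
  layer : ℕ → ℕ

variable {K d n : ℕ}

/-- The index `L = ⌈log₂ T⌉` of the last layer. -/
def Config.L (c : Config d) : ℕ := ⌈Real.logb 2 (c.T : ℝ)⌉₊

namespace Trajectory

/-- The feature `x_{t,a_t}` of the played action. -/
def played (h : Trajectory K d n) (t : ℕ) : Fin d → ℝ := h.x t (h.act t)

/-! ### Offline objects -/

def Goff (h : Trajectory K d n) : Matrix (Fin d) (Fin d) ℝ :=
  1 + ∑ i, vecMulVec (h.z i) (h.z i)

def thetaOff (h : Trajectory K d n) : Fin d → ℝ :=
  h.Goff⁻¹ *ᵥ (∑ i, h.y i • h.z i)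

def betaOff (h : Trajectory K d n) (c : Config d) : ℝ :=
  c.σ * Real.sqrt (2 * Real.log (Real.sqrt h.Goff.det / c.δoff)) + c.S

/-! ### Online objects of layer `l` before round `t` -/

/-- The rounds before `t` that were assigned to layer `l`. With `t = T` this is the set of all
rounds of that layer. -/
def hist (h : Trajectory K d n) (t l : ℕ) : Finset ℕ :=
  (Finset.range t).filter (fun s => h.layer s = l)

def A (h : Trajectory K d n) (t l : ℕ) : Matrix (Fin d) (Fin d) ℝ :=
  ∑ s ∈ h.hist t l, vecMulVec (h.played s) (h.played s)

def V (h : Trajectory K d n) (t l : ℕ) : Matrix (Fin d) (Fin d) ℝ := 1 + h.A t l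

def b (h : Trajectory K d n) (t l : ℕ) : Fin d → ℝ :=
  ∑ s ∈ h.hist t l, h.r s • h.played s

def thetaOn (h : Trajectory K d n) (t l : ℕ) : Fin d → ℝ := (h.V t l)⁻¹ *ᵥ h.b t l

def betaOn (h : Trajectory K d n) (c : Config d) (t l : ℕ) : ℝ :=
  c.σ * Real.sqrt (2 * Real.log (Real.sqrt (h.V t l).det / c.δonline t l)) + c.S

def radOn (h : Trajectory K d n) (c : Config d) (t l : ℕ) (v : Fin d → ℝ) : ℝ :=
  h.betaOn c t l * mnorm (h.V t l)⁻¹ v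

/-! ### Pooled objects of layer `l` before round `t` -/

def thetaPool (h : Trajectory K d n) (t l : ℕ) : Fin d → ℝ :=
  (h.A t l + h.Goff)⁻¹ *ᵥ (h.b t l + h.Goff *ᵥ h.thetaOff)

def gammaPool (h : Trajectory K d n) (c : Config d) (t l : ℕ) : ℝ :=
  c.σ * Real.sqrt (2 * Real.log
    (Real.sqrt (h.A t l + h.Goff).det / (Real.sqrt h.Goff.det * c.δpool t l)))

/-- The bias routing term `‖M^{-1/2} G (A + G)⁻¹ v‖₂`. -/
def psi (h : Trajectory K d n) (c : Config d) (t l : ℕ) (v : Fin d → ℝ) : ℝ :=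
  l2norm (((msqrt c.M)⁻¹ * h.Goff * (h.A t l + h.Goff)⁻¹) *ᵥ v)

def radPool (h : Trajectory K d n) (c : Config d) (t l : ℕ) (v : Fin d → ℝ) : ℝ :=
  (h.gammaPool c t l + h.betaOff c) * mnorm (h.A t l + h.Goff)⁻¹ v + c.ρ * h.psi c t l v

/-! ### Aggregated scores -/

def Umin (h : Trajectory K d n) (c : Config d) (t l : ℕ) (a : Fin K) : ℝ :=
  min (h.x t a ⬝ᵥ h.thetaOn t l + h.radOn c t l (h.x t a))
    (h.x t a ⬝ᵥ h.thetaPool t l + h.radPool c t l (h.x t a))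

def Lmax (h : Trajectory K d n) (c : Config d) (t l : ℕ) (a : Fin K) : ℝ :=
  max (h.x t a ⬝ᵥ h.thetaOn t l - h.radOn c t l (h.x t a))
    (h.x t a ⬝ᵥ h.thetaPool t l - h.radPool c t l (h.x t a))

def width (h : Trajectory K d n) (c : Config d) (t l : ℕ) (a : Fin K) : ℝ :=
  h.Umin c t l a - h.Lmax c t l a

/-- The surviving actions at layer `l` of round `t`: an action of the previous layer survives iff
its upper score is at least the maximum of the lower scores over that layer. -/
def active (h : Trajectory K d n) (c : Config d) (t : ℕ) : ℕ → Set (Fin K)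
  | 0 => Set.univ
  | l + 1 => {a | a ∈ active h c t l ∧ ∀ a' ∈ active h c t l, h.Lmax c t l a' ≤ h.Umin c t l a}

/-- The actions that may be played when round `t` stops at layer `l`: at the last layer, the
maximizers of the upper score over the surviving actions; at an earlier layer, its maximizers over
the surviving actions of width more than `2⁻ˡ`. -/
def playable (h : Trajectory K d n) (c : Config d) (t l : ℕ) : Set (Fin K) :=
  let C : Set (Fin K) :=
    {a | a ∈ h.active c t l ∧ (l ≠ c.L → (1 / 2 : ℝ) ^ l < h.width c t l a)}
  {a | a ∈ C ∧ ∀ a' ∈ C, h.Umin c t l a' ≤ h.Umin c t l a}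

/-- The trajectory is produced by the algorithm (ties broken arbitrarily): each round descends
through the layers all of whose surviving actions have width at most `2⁻ˡ`, stops at the first
other layer or at layer `L`, and plays a playable action there.
If the confidence intervals are inconsistent, every action may have been eliminated, in which case
the algorithm does not say what to play; then the choice of the action is unconstrained. -/
def IsRun (h : Trajectory K d n) (c : Config d) : Prop :=
  ∀ t < c.T,
    h.layer t ≤ c.L ∧
    (∀ l < h.layer t, ∀ a ∈ h.active c t l, h.width c t l a ≤ (1 / 2 : ℝ) ^ l) ∧
    ((h.active c t (h.layer t)).Nonempty → h.act t ∈ h.playable c t (h.layer t)) ∧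
    (h.active c t (h.layer t) = ∅ → h.layer t = c.L)

/-! ### Quantities in the regret bounds -/

/-- Cumulative regret with respect to the parameter `θ`. -/
def regret (h : Trajectory K d n) (c : Config d) (θ : Fin d → ℝ) : ℝ :=
  ∑ t ∈ Finset.range c.T, ((⨆ a : Fin K, h.x t a ⬝ᵥ θ) - h.played t ⬝ᵥ θ)

/-- Pooled log-determinant increment of layer `l`. -/
def Lam (h : Trajectory K d n) (c : Config d) (l : ℕ) : ℝ :=
  Real.log ((h.A c.T l + h.Goff).det / h.Goff.det)

def LamSum (h : Trajectory K d n) (c : Config d) : ℝ :=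
  ∑ l ∈ Finset.range (c.L + 1), h.Lam c l

def LamMax (h : Trajectory K d n) (c : Config d) : ℝ := ⨆ l : Fin (c.L + 1), h.Lam c l

def PsiSum (h : Trajectory K d n) (c : Config d) : ℝ :=
  ∑ t ∈ Finset.range c.T, h.psi c t (h.layer t) (h.played t)

end Trajectory

/-- The smallest pooled confidence budget. -/
def Config.δpoolMin (c : Config d) : ℝ :=
  ⨅ p : Fin c.T × Fin (c.L + 1), c.δpool p.1 p.2

/-- `L_T = log (2 K T log T / δ_on)`. -/
def Config.logFactor (c : Config d) (K : ℕ) : ℝ :=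
  Real.log (2 * K * c.T * Real.log c.T / c.δon)

namespace Trajectory

def GammaPool (h : Trajectory K d n) (c : Config d) : ℝ :=
  h.betaOff c + c.σ * Real.sqrt (h.LamMax c + 2 * Real.log (1 / c.δpoolMin))

/-- `λ_max (G^{1/2} M⁻¹ G^{1/2})`. -/
def cAlign (h : Trajectory K d n) (c : Config d) : ℝ :=
  lambdaMax (msqrt h.Goff * c.M⁻¹ * msqrt h.Goff)

/-- The pooled term `8 Γ √(2 T Λ) + 8 ρ Ψ`. -/
def pooledTerm (h : Trajectory K d n) (c : Config d) : ℝ :=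
  8 * h.GammaPool c * Real.sqrt (2 * c.T * h.LamSum c) + 8 * c.ρ * h.PsiSum c

/-- The aligned pooled term `8 (Γ + ρ √c_align) √(2 T Λ)`. -/
def alignedPooledTerm (h : Trajectory K d n) (c : Config d) : ℝ :=
  8 * (h.GammaPool c + c.ρ * Real.sqrt (h.cAlign c)) * Real.sqrt (2 * c.T * h.LamSum c)

/-- The simultaneous confidence event, read along a trajectory. -/
def Good (h : Trajectory K d n) (c : Config d) (θ θd : Fin d → ℝ) : Prop :=
  mnorm h.Goff (h.thetaOff - θd) ≤ h.betaOff c ∧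
  ∀ t < c.T, ∀ l ≤ c.L,
    mnorm (h.V t l)⁻¹ (h.b t l - h.A t l *ᵥ θ) ≤ h.betaOn c t l - c.S ∧
    mnorm (h.A t l + h.Goff)⁻¹ (h.b t l - h.A t l *ᵥ θ) ≤ h.gammaPool c t l

end Trajectory

/-- The online fallback `C √(T d L_T³)`. -/
def fallback (C : ℝ) (c : Config d) (K : ℕ) : ℝ :=
  C * Real.sqrt (c.T * d * c.logFactor K ^ 3)

/-! ### Standing assumptions -/

/-- Admissible inputs: `T ≥ 1`, `σ ≥ 0`, positive budgets with the prescribed sums. -/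
structure Config.Admissible (c : Config d) : Prop where
  one_le_T : 1 ≤ c.T
  σ_nonneg : 0 ≤ c.σ
  δoff_pos : 0 < c.δoff
  δon_pos : 0 < c.δon
  δonline_pos : ∀ t < c.T, ∀ l ≤ c.L, 0 < c.δonline t l
  δpool_pos : ∀ t < c.T, ∀ l ≤ c.L, 0 < c.δpool t l
  sum_online :
    ∑ t ∈ Finset.range c.T, ∑ l ∈ Finset.range (c.L + 1), c.δonline t l ≤ c.δon
  sum_all :
    c.δoff + c.δon + ∑ t ∈ Finset.range c.T, ∑ l ∈ Finset.range (c.L + 1), c.δpool t l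
      ≤ 1 / (c.T : ℝ) ^ 2

/-- `(M, ρ)` is a valid directional bias certificate for `(θ, θd)`. -/
def Config.ValidCertificate (c : Config d) (θ θd : Fin d → ℝ) : Prop :=
  c.M.PosDef ∧ 0 ≤ c.ρ ∧ mnorm c.M (θ - θd) ≤ c.ρ

/-- `X` is conditionally `σ`-sub-Gaussian given `m`. -/
def CondSubGaussian {Ω : Type*} {mΩ : MeasurableSpace Ω} (μ : Measure Ω) (m : MeasurableSpace Ω)
    (σ : ℝ) (X : Ω → ℝ) : Prop :=
  ∀ u : ℝ, Integrable (fun ω => Real.exp (u * X ω)) μ ∧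
    ∀ᵐ ω ∂μ, (μ[fun ω => Real.exp (u * X ω) | m]) ω ≤ Real.exp (u ^ 2 * σ ^ 2 / 2)

/-- Conditionally centred, conditionally `σ`-sub-Gaussian noise. -/
def CondNoise {Ω : Type*} {mΩ : MeasurableSpace Ω} (μ : Measure Ω) (m : MeasurableSpace Ω)
    (σ : ℝ) (X : Ω → ℝ) : Prop :=
  (∀ᵐ ω ∂μ, (μ[X | m]) ω = 0) ∧ CondSubGaussian μ m σ X

/-- Online model: bounded features and parameter, linear rewards in `[0, 1]`, and a filtration
`ℱ`, where `ℱ t` is the information available in round `t` before its reward: it contains the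
offline covariates, the past rewards, the contexts and decisions of round `t`. The noise
`r_t - x_{t,a_t}ᵀ θ` is centred and sub-Gaussian given `ℱ t`. -/
structure OnlineModel {Ω : Type*} {mΩ : MeasurableSpace Ω} (μ : Measure Ω)
    (c : Config d) (θ : Fin d → ℝ) (ℱ : Filtration ℕ mΩ) (H : Ω → Trajectory K d n) : Prop where
  theta_le : l2norm θ ≤ c.S
  x_le : ∀ t < c.T, ∀ a ω, l2norm ((H ω).x t a) ≤ 1
  mean_mem : ∀ t < c.T, ∀ a ω, (H ω).x t a ⬝ᵥ θ ∈ Set.Icc (0 : ℝ) 1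
  r_mem : ∀ t < c.T, ∀ ω, (H ω).r t ∈ Set.Icc (0 : ℝ) 1
  z_meas : ∀ i, Measurable[ℱ 0] fun ω => (H ω).z i
  x_meas : ∀ t < c.T, ∀ a, Measurable[ℱ t] fun ω => (H ω).x t a
  act_meas : ∀ t < c.T, Measurable[ℱ t] fun ω => (H ω).act t
  layer_meas : ∀ t < c.T, Measurable[ℱ t] fun ω => (H ω).layer t
  r_meas : ∀ t < c.T, Measurable fun ω => (H ω).r t
  r_past : ∀ t < c.T, ∀ s < t, Measurable[ℱ t] fun ω => (H ω).r s
  noise : ∀ t < c.T, CondNoise μ (ℱ t) c.σ fun ω => (H ω).r t - (H ω).played t ⬝ᵥ θ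

/-- The σ-algebra generated by all offline covariates and the responses `y j`, `j < i`. -/
abbrev offlineInfo {Ω : Type*} (H : Ω → Trajectory K d n) (i : Fin n) : MeasurableSpace Ω :=
  (⨆ j : Fin n, MeasurableSpace.comap (fun ω => (H ω).z j) inferInstance) ⊔
    (⨆ j : Fin n, ⨆ _ : j < i, MeasurableSpace.comap (fun ω => (H ω).y j) inferInstance)

/-- Offline regression model with non-adaptive covariates: the noise `y i - z iᵀ θd` is centred and
sub-Gaussian given all the covariates and the previous responses. -/
structure OfflineModel {Ω : Type*} {mΩ : MeasurableSpace Ω} (μ : Measure Ω)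
    (c : Config d) (θd : Fin d → ℝ) (H : Ω → Trajectory K d n) : Prop where
  theta_le : l2norm θd ≤ c.S
  z_le : ∀ i ω, l2norm ((H ω).z i) ≤ 1
  z_meas : ∀ i, Measurable fun ω => (H ω).z i
  y_meas : ∀ i, Measurable fun ω => (H ω).y i
  noise : ∀ i, CondNoise μ (offlineInfo H i) c.σ fun ω => (H ω).y i - (H ω).z i ⬝ᵥ θd

end

end EllipsoidalMinUCB

namespace EllipsoidalMinUCB

/-! ### Weighted norms, rank-one updates and the Loewner order. -/

section LinearAlgebra

variable {d : ℕ} {P Q A : Matrix (Fin d) (Fin d) ℝ}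

/-! The proof separates a deterministic regret bound, valid along every trajectory on which the
confidence event holds, from a probability estimate for that event.

Regret. On the event both intervals contain the true mean, so their intersection does too, and a
best action is never eliminated. The layer structure then bounds the regret of a round by four
widths of the played action at its stopping layer (`round_regret_le`). An intersection is no wider
than the pooled interval, that is, than two pooled radii, which gives the factor 8. In the sum of
the radii, the norm part is handled layer by layer: each played feature multiplies `det (A + G)` by
one plus its squared norm, so the logarithms telescope to `Lam` (`sum_log_one_add`), and
Cauchy–Schwarz over rounds gives `√(2 T Λ)`. The bias part is kept as `PsiSum`, or compared with the
same norms through a Rayleigh quotient (`psi_le`). The comparison with the fallback is then a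
comparison of squares, with `128 = 8² · 2`.

Probability. Every confidence bound is a self-normalized tail bound at a fixed time
(`measure_mnorm_gt_le`), obtained by the method of mixtures. The mixture is carried out one
observation at a time: the factor gained in a step is a one-dimensional Gaussian average of
exponential tilts whose mean and variance are predictable (`mixtureProcess_succ`,
`CondSubGaussian.lintegral_mul_mixture_le`), so the process has expectation at most 1, and Markov's
inequality applies. The prior precision may be random as long as it is known beforehand; it is `1`
for the offline and online bounds and `G` for the pooled one. A union bound over rounds and layers
finishes. -/

lemma dotProduct_mulVec_comm_of_isHermitian (hQ : Q.IsHermitian) (v w : Fin d → ℝ) :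
    v ⬝ᵥ (Q *ᵥ w) = (Q *ᵥ v) ⬝ᵥ w := by
  have h : Qᵀ = Q := by simpa [Matrix.IsHermitian, conjTranspose_eq_transpose_of_trivial] using hQ
  rw [dotProduct_mulVec, ← mulVec_transpose, h]

lemma quadForm_nonneg (hQ : Q.PosSemidef) (v : Fin d → ℝ) : 0 ≤ v ⬝ᵥ (Q *ᵥ v) := by
  simpa using hQ.dotProduct_mulVec_nonneg v

lemma mnorm_nonneg (Q : Matrix (Fin d) (Fin d) ℝ) (v : Fin d → ℝ) : 0 ≤ mnorm Q v :=
  Real.sqrt_nonneg _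

lemma mnorm_sq (hQ : Q.PosSemidef) (v : Fin d → ℝ) : mnorm Q v ^ 2 = v ⬝ᵥ (Q *ᵥ v) :=
  Real.sq_sqrt (quadForm_nonneg hQ v)

/-- Cauchy–Schwarz, from the discriminant of the nonnegative quadratic `t ↦ (v + t w)ᵀ Q (v + t w)`.
Definiteness is not needed. -/
lemma dotProduct_mulVec_sq_le (hQ : Q.PosSemidef) (v w : Fin d → ℝ) :
    (v ⬝ᵥ (Q *ᵥ w)) ^ 2 ≤ (v ⬝ᵥ (Q *ᵥ v)) * (w ⬝ᵥ (Q *ᵥ w)) := by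
  have key : ∀ t : ℝ, 0 ≤ (w ⬝ᵥ (Q *ᵥ w)) * (t * t) + 2 * (v ⬝ᵥ (Q *ᵥ w)) * t
      + v ⬝ᵥ (Q *ᵥ v) := by
    intro t
    have h := quadForm_nonneg hQ (v + t • w)
    have hs : w ⬝ᵥ (Q *ᵥ v) = v ⬝ᵥ (Q *ᵥ w) := by
      rw [dotProduct_mulVec_comm_of_isHermitian hQ.1, dotProduct_comm]
    simp only [mulVec_add, mulVec_smul, add_dotProduct, dotProduct_add, smul_dotProduct,
      dotProduct_smul, smul_eq_mul, hs] at h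
    linarith
  have h := discrim_le_zero key
  rw [discrim] at h
  linarith

lemma abs_dotProduct_mulVec_le (hQ : Q.PosSemidef) (v w : Fin d → ℝ) :
    |v ⬝ᵥ (Q *ᵥ w)| ≤ mnorm Q v * mnorm Q w := by
  apply abs_le_of_sq_le_sq _ (mul_nonneg (mnorm_nonneg _ _) (mnorm_nonneg _ _))
  rw [mul_pow, mnorm_sq hQ, mnorm_sq hQ]
  exact dotProduct_mulVec_sq_le hQ v w

lemma mnorm_add_le (hQ : Q.PosSemidef) (v w : Fin d → ℝ) :
    mnorm Q (v + w) ≤ mnorm Q v + mnorm Q w := by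
  apply le_of_sq_le_sq _ (add_nonneg (mnorm_nonneg _ _) (mnorm_nonneg _ _))
  have hs : w ⬝ᵥ (Q *ᵥ v) = v ⬝ᵥ (Q *ᵥ w) := by
    rw [dotProduct_mulVec_comm_of_isHermitian hQ.1, dotProduct_comm]
  have h := le_of_abs_le (abs_dotProduct_mulVec_le hQ v w)
  rw [add_sq, mnorm_sq hQ, mnorm_sq hQ, mnorm_sq hQ]
  simp only [mulVec_add, add_dotProduct, dotProduct_add, hs]
  linarith

lemma mnorm_neg (Q : Matrix (Fin d) (Fin d) ℝ) (v : Fin d → ℝ) : mnorm Q (-v) = mnorm Q v := by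
  simp [mnorm, mulVec_neg]

lemma mnorm_sub_le (hQ : Q.PosSemidef) (v w : Fin d → ℝ) :
    mnorm Q (v - w) ≤ mnorm Q v + mnorm Q w := by
  rw [sub_eq_add_neg, ← mnorm_neg Q w]
  exact mnorm_add_le hQ v (-w)

lemma mnorm_one (v : Fin d → ℝ) : mnorm 1 v = l2norm v := by simp [mnorm, l2norm]

lemma inv_mulVec_mulVec (hP : P.PosDef) (v : Fin d → ℝ) : P⁻¹ *ᵥ (P *ᵥ v) = v := by
  rw [mulVec_mulVec, nonsing_inv_mul _ ((isUnit_iff_isUnit_det _).1 hP.isUnit), one_mulVec]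

lemma mulVec_inv_mulVec (hP : P.PosDef) (v : Fin d → ℝ) : P *ᵥ (P⁻¹ *ᵥ v) = v := by
  rw [mulVec_mulVec, mul_nonsing_inv _ ((isUnit_iff_isUnit_det _).1 hP.isUnit), one_mulVec]

lemma mnorm_inv_mulVec (hP : P.PosDef) (v : Fin d → ℝ) : mnorm P⁻¹ (P *ᵥ v) = mnorm P v := by
  rw [mnorm, mnorm, inv_mulVec_mulVec hP, ← dotProduct_mulVec_comm_of_isHermitian hP.1]

lemma mnorm_mulVec_inv (hP : P.PosDef) (v : Fin d → ℝ) : mnorm P (P⁻¹ *ᵥ v) = mnorm P⁻¹ v := by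
  rw [mnorm, mnorm, mulVec_inv_mulVec hP, ← dotProduct_mulVec_comm_of_isHermitian hP.inv.1]

/-- Inversion is antitone in the Loewner order. -/
lemma inv_quadForm_le (hP : P.PosDef) (hA : A.PosSemidef) (v : Fin d → ℝ) :
    v ⬝ᵥ ((P + A)⁻¹ *ᵥ v) ≤ v ⬝ᵥ (P⁻¹ *ᵥ v) := by
  have hQ := hP.add_posSemidef hA
  set w := (P + A)⁻¹ *ᵥ v with hw
  have h1 : (P + A) *ᵥ w = v := mulVec_inv_mulVec hQ v
  -- Cauchy–Schwarz reads `(v·w)² ≤ (v·P⁻¹v)(w·Pw)`. Since `w·Pw ≤ w·(P+A)w = v·w`, one factor `v·w`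
  -- cancels.
  have h2 := dotProduct_mulVec_sq_le hP.inv.posSemidef v (P *ᵥ w)
  rw [inv_mulVec_mulVec hP, ← dotProduct_mulVec_comm_of_isHermitian hP.1] at h2
  have h3 : w ⬝ᵥ (P *ᵥ w) ≤ v ⬝ᵥ w := by
    have h := quadForm_nonneg hA w
    have h' := congrArg (w ⬝ᵥ ·) h1
    simp only [add_mulVec, dotProduct_add] at h'
    rw [dotProduct_comm v w]
    linarith
  have h4 := quadForm_nonneg hP.inv.posSemidef v
  have h5 : 0 ≤ v ⬝ᵥ w := quadForm_nonneg hQ.inv.posSemidef v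
  rcases h5.eq_or_lt with h | h
  · rw [← h]; exact h4
  · nlinarith [mul_le_mul_of_nonneg_left h3 h4]

lemma mnorm_inv_add_le (hP : P.PosDef) (hA : A.PosSemidef) (v : Fin d → ℝ) :
    mnorm (P + A)⁻¹ v ≤ mnorm P⁻¹ v :=
  Real.sqrt_le_sqrt (inv_quadForm_le hP hA v)

lemma posSemidef_vecMulVec_self (x : Fin d → ℝ) : (vecMulVec x x).PosSemidef := by
  simpa using posSemidef_vecMulVec_self_star x

lemma posSemidef_sum_vecMulVec {ι : Type*} (s : Finset ι) (x : ι → Fin d → ℝ) :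
    (∑ i ∈ s, vecMulVec (x i) (x i)).PosSemidef :=
  posSemidef_sum s fun i _ => posSemidef_vecMulVec_self (x i)

lemma vecMulVec_self_mulVec (x v : Fin d → ℝ) : vecMulVec x x *ᵥ v = (x ⬝ᵥ v) • x := by
  rw [vecMulVec_mulVec]; simp

/-- Rank-one determinant update. -/
lemma det_add_vecMulVec (hP : P.PosDef) (x : Fin d → ℝ) :
    (P + vecMulVec x x).det = P.det * (1 + x ⬝ᵥ (P⁻¹ *ᵥ x)) := by
  have h := det_add_replicateCol_mul_replicateRow (ι := Unit)
    ((isUnit_iff_isUnit_det _).1 hP.isUnit) x x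
  rw [vecMulVec_eq Unit, h, ← replicateRow_vecMul]
  congr 1
  rw [det_unique]
  simp only [Matrix.add_apply, Matrix.one_apply_eq, Matrix.mul_apply]
  exact congrArg _ (dotProduct_mulVec x P⁻¹ x).symm

/-- Rank-one update of the inverse applied to a vector. -/
lemma inv_add_vecMulVec_mulVec (hP : P.PosDef) (x v : Fin d → ℝ) :
    (P + vecMulVec x x)⁻¹ *ᵥ v =
      P⁻¹ *ᵥ v - ((x ⬝ᵥ (P⁻¹ *ᵥ v)) / (1 + x ⬝ᵥ (P⁻¹ *ᵥ x))) • (P⁻¹ *ᵥ x) := by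
  have hQ := hP.add_posSemidef (posSemidef_vecMulVec_self x)
  have hq := quadForm_nonneg hP.inv.posSemidef x
  -- It suffices that `P + xxᵀ` maps the claimed right-hand side to `v`.
  rw [← inv_mulVec_mulVec hQ (P⁻¹ *ᵥ v - _)]
  congr 1
  rw [mulVec_sub, mulVec_smul, add_mulVec, add_mulVec, mulVec_inv_mulVec hP, mulVec_inv_mulVec hP,
    vecMulVec_self_mulVec, vecMulVec_self_mulVec]
  have h : (1 : ℝ) + x ⬝ᵥ (P⁻¹ *ᵥ x) ≠ 0 := by positivity
  ext i
  simp only [Pi.sub_apply, Pi.add_apply, Pi.smul_apply, smul_eq_mul]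
  field_simp
  ring

/-- Effect of one more observation on the self-normalized squared norm. -/
lemma inv_quadForm_update (hP : P.PosDef) (x s : Fin d → ℝ) (η : ℝ) :
    (s + η • x) ⬝ᵥ ((P + vecMulVec x x)⁻¹ *ᵥ (s + η • x)) =
      s ⬝ᵥ (P⁻¹ *ᵥ s) + ((x ⬝ᵥ (P⁻¹ *ᵥ x)) * η ^ 2 + 2 * (x ⬝ᵥ (P⁻¹ *ᵥ s)) * η
        - (x ⬝ᵥ (P⁻¹ *ᵥ s)) ^ 2) / (1 + x ⬝ᵥ (P⁻¹ *ᵥ x)) := by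
  have hq := quadForm_nonneg hP.inv.posSemidef x
  have hs : s ⬝ᵥ (P⁻¹ *ᵥ x) = x ⬝ᵥ (P⁻¹ *ᵥ s) := by
    rw [dotProduct_mulVec_comm_of_isHermitian hP.inv.1, dotProduct_comm]
  rw [inv_add_vecMulVec_mulVec hP]
  simp only [mulVec_add, mulVec_smul, add_dotProduct, dotProduct_add, smul_dotProduct,
    dotProduct_smul, dotProduct_sub, smul_eq_mul, hs]
  field_simp
  ring

lemma det_le_det_add (hP : P.PosDef) {ι : Type*} (s : Finset ι) (x : ι → Fin d → ℝ) :
    P.det ≤ (P + ∑ i ∈ s, vecMulVec (x i) (x i)).det := by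
  classical
  induction s using Finset.induction_on with
  | empty => simp
  | insert a s ha ih =>
    have hQ := hP.add_posSemidef (posSemidef_sum_vecMulVec s x)
    rw [Finset.sum_insert ha, add_comm (vecMulVec _ _), ← add_assoc, det_add_vecMulVec hQ]
    have := quadForm_nonneg hQ.inv.posSemidef (x a)
    nlinarith [hQ.det_pos]

/-! ### Matrix square roots and the largest eigenvalue -/

lemma isHermitian_msqrt (P : Matrix (Fin d) (Fin d) ℝ) : (msqrt P).IsHermitian :=
  cfc_predicate Real.sqrt P

lemma msqrt_mul_self (hP : P.PosSemidef) : msqrt P * msqrt P = P := by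
  have hsa : IsSelfAdjoint P := hP.1
  rw [msqrt, ← cfc_mul Real.sqrt Real.sqrt P]
  conv_rhs => rw [← cfc_id ℝ P]
  apply cfc_congr
  intro x hx
  have := (posSemidef_iff_isHermitian_and_spectrum_nonneg.1 hP).2 hx
  exact Real.mul_self_sqrt this

lemma isUnit_det_msqrt (hP : P.PosDef) : IsUnit (msqrt P).det := by
  have h := congrArg det (msqrt_mul_self hP.posSemidef)
  rw [det_mul] at h
  have := hP.det_pos
  rw [isUnit_iff_ne_zero]
  intro h0
  rw [h0] at h
  linarith

lemma l2norm_msqrt_mulVec (hP : P.PosSemidef) (v : Fin d → ℝ) :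
    l2norm (msqrt P *ᵥ v) = mnorm P v := by
  rw [l2norm, mnorm, ← dotProduct_mulVec_comm_of_isHermitian (isHermitian_msqrt P), mulVec_mulVec,
    msqrt_mul_self hP]

lemma isHermitian_msqrt_inv (P : Matrix (Fin d) (Fin d) ℝ) : (msqrt P)⁻¹.IsHermitian :=
  (isHermitian_msqrt P).inv

lemma l2norm_msqrt_inv_mulVec (hP : P.PosDef) (v : Fin d → ℝ) :
    l2norm ((msqrt P)⁻¹ *ᵥ v) = mnorm P⁻¹ v := by
  rw [l2norm, mnorm, ← dotProduct_mulVec_comm_of_isHermitian (isHermitian_msqrt_inv P),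
    mulVec_mulVec, ← Matrix.mul_inv_rev, msqrt_mul_self hP.posSemidef]

lemma abs_dotProduct_le (v w : Fin d → ℝ) : |v ⬝ᵥ w| ≤ l2norm v * l2norm w := by
  have := abs_dotProduct_mulVec_le (Q := 1) Matrix.PosSemidef.one v w
  simpa [mnorm_one] using this

/-- A symmetric matrix lies below any scalar bounding its spectrum in the Loewner order; the
spectrum is finite, so its supremum is such a bound. -/
lemma quadForm_le_lambdaMax (hQ : Q.IsHermitian) (v : Fin d → ℝ) :
    v ⬝ᵥ (Q *ᵥ v) ≤ lambdaMax Q * (v ⬝ᵥ v) := by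
  open scoped MatrixOrder in
  have h : Q ≤ algebraMap ℝ _ (lambdaMax Q) :=
    le_algebraMap_of_spectrum_le (a := Q)
      (fun x hx => le_csSup (Q.finite_real_spectrum).bddAbove hx) hQ
  rw [Matrix.le_iff] at h
  have := quadForm_nonneg h v
  rw [sub_mulVec, dotProduct_sub, Algebra.algebraMap_eq_smul_one, smul_mulVec, one_mulVec,
    dotProduct_smul, smul_eq_mul] at this
  linarith

end LinearAlgebra

/-! ### The deterministic analysis along one trajectory. -/

namespace Trajectory

variable {K d n : ℕ}

variable (h : Trajectory K d n) (c : Config d) (t l : ℕ)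

lemma posDef_Goff : h.Goff.PosDef :=
  PosDef.one.add_posSemidef (posSemidef_sum_vecMulVec _ _)

lemma posSemidef_A : (h.A t l).PosSemidef := posSemidef_sum_vecMulVec _ _

lemma posDef_V : (h.V t l).PosDef := PosDef.one.add_posSemidef (h.posSemidef_A t l)

lemma posDef_pool : (h.A t l + h.Goff).PosDef :=
  PosDef.posSemidef_add (h.posSemidef_A t l) h.posDef_Goff

lemma mnorm_pool_inv_le_Goff (v : Fin d → ℝ) :
    mnorm (h.A t l + h.Goff)⁻¹ v ≤ mnorm h.Goff⁻¹ v := by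
  rw [add_comm]
  exact mnorm_inv_add_le h.posDef_Goff (h.posSemidef_A t l) v

lemma mnorm_V_inv_le (v : Fin d → ℝ) : mnorm (h.V t l)⁻¹ v ≤ l2norm v := by
  rw [← mnorm_one, ← inv_one]
  exact mnorm_inv_add_le PosDef.one (h.posSemidef_A t l) v

lemma mnorm_Goff_inv_le (v : Fin d → ℝ) : mnorm h.Goff⁻¹ v ≤ l2norm v := by
  rw [← mnorm_one, ← inv_one]
  exact mnorm_inv_add_le PosDef.one (posSemidef_sum_vecMulVec _ _) v

lemma mnorm_pool_inv_le (v : Fin d → ℝ) : mnorm (h.A t l + h.Goff)⁻¹ v ≤ l2norm v :=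
  (h.mnorm_pool_inv_le_Goff t l v).trans (h.mnorm_Goff_inv_le v)

/-! ### Validity of the two confidence intervals -/

/-- The ridge estimator has error `V⁻¹ (noise - θ)`. Because `V ⪰ 1`, the regularization term costs
at most `‖θ‖₂ ≤ S`, which is the summand `S` of `betaOn`. -/
lemma abs_online_error_le {θ : Fin d → ℝ} (hθ : l2norm θ ≤ c.S)
    (hb : mnorm (h.V t l)⁻¹ (h.b t l - h.A t l *ᵥ θ) ≤ h.betaOn c t l - c.S)
    (x : Fin d → ℝ) : |x ⬝ᵥ h.thetaOn t l - x ⬝ᵥ θ| ≤ h.radOn c t l x := by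
  have hV := h.posDef_V t l
  have e : x ⬝ᵥ h.thetaOn t l - x ⬝ᵥ θ =
      x ⬝ᵥ ((h.V t l)⁻¹ *ᵥ (h.b t l - h.A t l *ᵥ θ - θ)) := by
    have : h.b t l - h.A t l *ᵥ θ - θ = h.b t l - h.V t l *ᵥ θ := by
      rw [V, add_mulVec, one_mulVec]; abel
    rw [this, mulVec_sub, inv_mulVec_mulVec hV, dotProduct_sub, thetaOn]
  rw [e]
  refine (abs_dotProduct_mulVec_le hV.inv.posSemidef _ _).trans ?_
  rw [radOn, mul_comm]
  refine mul_le_mul_of_nonneg_right ?_ (mnorm_nonneg _ _)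
  have := mnorm_sub_le hV.inv.posSemidef (h.b t l - h.A t l *ᵥ θ) θ
  have := h.mnorm_V_inv_le t l θ
  linarith

/-- Inserting `M^{-1/2} M^{1/2}` in front of `θd - θ` and applying Cauchy–Schwarz separates the
certificate `‖θ - θd‖_M ≤ ρ` from the routing term `psi`. -/
lemma abs_bias_le {θ θd : Fin d → ℝ} (hcert : c.ValidCertificate θ θd) (x : Fin d → ℝ) :
    |x ⬝ᵥ ((h.A t l + h.Goff)⁻¹ *ᵥ (h.Goff *ᵥ (θd - θ)))| ≤ c.ρ * h.psi c t l x := by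
  obtain ⟨hM, -, hρ⟩ := hcert
  have e : x ⬝ᵥ ((h.A t l + h.Goff)⁻¹ *ᵥ (h.Goff *ᵥ (θd - θ))) =
      (((msqrt c.M)⁻¹ * h.Goff * (h.A t l + h.Goff)⁻¹) *ᵥ x) ⬝ᵥ (msqrt c.M *ᵥ (θd - θ)) := by
    rw [← mulVec_mulVec, ← mulVec_mulVec,
      ← dotProduct_mulVec_comm_of_isHermitian (isHermitian_msqrt_inv c.M),
      mulVec_mulVec (θd - θ) (msqrt c.M)⁻¹, nonsing_inv_mul _ (isUnit_det_msqrt hM), one_mulVec,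
      ← dotProduct_mulVec_comm_of_isHermitian h.posDef_Goff.1,
      ← dotProduct_mulVec_comm_of_isHermitian (h.posDef_pool t l).inv.1]
  rw [e]
  refine (abs_dotProduct_le _ _).trans ?_
  rw [l2norm_msqrt_mulVec hM.posSemidef, mul_comm c.ρ, ← neg_sub, mnorm_neg]
  exact mul_le_mul_of_nonneg_left hρ (Real.sqrt_nonneg _)

/-- The pooled error splits into online noise, offline estimation error and bias, paid for by
`gammaPool`, `betaOff` and `ρ ψ`. The offline part uses `A + G ⪰ G` to pass from the `(A +
G)⁻¹`-norm of `G (θ_off - θd)` to the `G`-norm of `θ_off - θd`. -/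
lemma abs_pool_error_le {θ θd : Fin d → ℝ} (hcert : c.ValidCertificate θ θd)
    (hoff : mnorm h.Goff (h.thetaOff - θd) ≤ h.betaOff c)
    (hb : mnorm (h.A t l + h.Goff)⁻¹ (h.b t l - h.A t l *ᵥ θ) ≤ h.gammaPool c t l)
    (x : Fin d → ℝ) : |x ⬝ᵥ h.thetaPool t l - x ⬝ᵥ θ| ≤ h.radPool c t l x := by
  have hQ := h.posDef_pool t l
  have hQi := hQ.inv.posSemidef
  have e : x ⬝ᵥ h.thetaPool t l - x ⬝ᵥ θ =
      x ⬝ᵥ ((h.A t l + h.Goff)⁻¹ *ᵥ (h.b t l - h.A t l *ᵥ θ + h.Goff *ᵥ (h.thetaOff - θd)))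
      + x ⬝ᵥ ((h.A t l + h.Goff)⁻¹ *ᵥ (h.Goff *ᵥ (θd - θ))) := by
    rw [← dotProduct_add, ← mulVec_add]
    have : h.b t l - h.A t l *ᵥ θ + h.Goff *ᵥ (h.thetaOff - θd) + h.Goff *ᵥ (θd - θ)
        = (h.b t l + h.Goff *ᵥ h.thetaOff) - (h.A t l + h.Goff) *ᵥ θ := by
      simp only [mulVec_sub, add_mulVec]; abel
    rw [this, mulVec_sub, inv_mulVec_mulVec hQ, dotProduct_sub, thetaPool]
  rw [e]
  refine (abs_add_le _ _).trans (add_le_add ?_ (h.abs_bias_le c t l hcert x))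
  refine (abs_dotProduct_mulVec_le hQi _ _).trans ?_
  rw [mul_comm]
  refine mul_le_mul_of_nonneg_right ?_ (mnorm_nonneg _ _)
  refine (mnorm_add_le hQi _ _).trans (add_le_add hb ?_)
  refine (h.mnorm_pool_inv_le_Goff t l _).trans ?_
  rwa [mnorm_inv_mulVec h.posDef_Goff]

variable {h c t l}

lemma Lmax_le_and_le_Umin {θ θd : Fin d → ℝ} (hcert : c.ValidCertificate θ θd)
    (hθ : l2norm θ ≤ c.S) (hgood : h.Good c θ θd) (ht : t < c.T) (hl : l ≤ c.L) (a : Fin K) :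
    h.Lmax c t l a ≤ h.x t a ⬝ᵥ θ ∧ h.x t a ⬝ᵥ θ ≤ h.Umin c t l a := by
  obtain ⟨h1, h2⟩ := hgood.2 t ht l hl
  have e1 := abs_le.1 (h.abs_online_error_le c t l hθ h1 (h.x t a))
  have e2 := abs_le.1 (h.abs_pool_error_le c t l hcert hgood.1 h2 (h.x t a))
  refine ⟨max_le ?_ ?_, le_min ?_ ?_⟩ <;> linarith [e1.1, e1.2, e2.1, e2.2]

/-! ### Elimination of actions and the regret of one round. -/

lemma width_le (a : Fin K) : h.width c t l a ≤ 2 * h.radPool c t l (h.x t a) := by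
  have h1 : h.Umin c t l a ≤ h.x t a ⬝ᵥ h.thetaPool t l + h.radPool c t l (h.x t a) :=
    min_le_right _ _
  have h2 : h.x t a ⬝ᵥ h.thetaPool t l - h.radPool c t l (h.x t a) ≤ h.Lmax c t l a :=
    le_max_right _ _
  rw [width]
  linarith

/-- A best action has upper score at least its own mean, hence at least every other mean and every
lower score, so it passes each elimination test. -/
lemma optimal_mem_active {θ θd : Fin d → ℝ} (hcert : c.ValidCertificate θ θd)
    (hθ : l2norm θ ≤ c.S) (hgood : h.Good c θ θd) (ht : t < c.T) {a : Fin K}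
    (ha : ∀ a', h.x t a' ⬝ᵥ θ ≤ h.x t a ⬝ᵥ θ) (hl : l ≤ c.L) : a ∈ h.active c t l := by
  induction l with
  | zero => exact Set.mem_univ a
  | succ l ih =>
    have hl' : l ≤ c.L := by omega
    refine ⟨ih hl', fun a' _ => ?_⟩
    have h1 := Lmax_le_and_le_Umin hcert hθ hgood ht hl' a
    have h2 := Lmax_le_and_le_Umin hcert hθ hgood ht hl' a'
    linarith [h1.2, h2.1, ha a']

/-- The regret is at most `4 · width`, and `width ≤ 2 · radPool`. At layer `L` the played action
maximizes the upper score, so one width suffices. At layer `0 < L` its width exceeds 1, which bounds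
any regret. At layer `k + 1 < L` its width exceeds `2^{-(k+1)}`, while the narrow intervals of layer
`k` bound the regret by `2 · 2^{-k}`. -/
lemma round_regret_le {θ θd : Fin d → ℝ} (hcert : c.ValidCertificate θ θd)
    (hθ : l2norm θ ≤ c.S) (hmean : ∀ a, h.x t a ⬝ᵥ θ ∈ Set.Icc (0 : ℝ) 1)
    (hrun : h.IsRun c) (hgood : h.Good c θ θd) (ht : t < c.T) :
    (⨆ a : Fin K, h.x t a ⬝ᵥ θ) - h.played t ⬝ᵥ θ ≤
      8 * h.radPool c t (h.layer t) (h.played t) := by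
  have : Nonempty (Fin K) := ⟨h.act t⟩
  obtain ⟨a, ha⟩ := Finite.exists_max fun a : Fin K => h.x t a ⬝ᵥ θ
  obtain ⟨hl, hnarrow, hplay, -⟩ := hrun t ht
  have hmem := optimal_mem_active hcert hθ hgood ht ha hl
  obtain ⟨⟨hact, hwide⟩, hmax⟩ := hplay ⟨a, hmem⟩
  have hci := fun l hl => Lmax_le_and_le_Umin (l := l) hcert hθ hgood ht hl
  have hsup : (⨆ a : Fin K, h.x t a ⬝ᵥ θ) ≤ h.x t a ⬝ᵥ θ := ciSup_le ha
  have hw := width_le (h := h) (c := c) (t := t) (l := h.layer t) (h.act t)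
  have hia := hci _ hl a
  have hip := hci _ hl (h.act t)
  have hw' : h.width c t (h.layer t) (h.act t) =
    h.Umin c t (h.layer t) (h.act t) - h.Lmax c t (h.layer t) (h.act t) := rfl
  suffices (⨆ a : Fin K, h.x t a ⬝ᵥ θ) - h.played t ⬝ᵥ θ
      ≤ 4 * h.width c t (h.layer t) (h.act t) by
    have e : h.played t = h.x t (h.act t) := rfl
    rw [e] at this ⊢
    linarith
  change _ - h.x t (h.act t) ⬝ᵥ θ ≤ _
  by_cases hL : h.layer t = c.L
  -- At the last layer the width condition on candidates is void, so the best action is itself a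
  -- candidate.
  · have := hmax a ⟨hmem, fun hne => absurd hL hne⟩
    linarith [hia.1, hia.2, hip.1, hip.2]
  · have hwide := hwide hL
    rcases hk : h.layer t with _ | k
    · rw [hk] at hwide
      have := (hmean a).2
      have := (hmean (h.act t)).1
      norm_num at hwide
      linarith
    -- Both actions were narrow at layer `k`, and the played one survived there, so its upper score
    -- is at least the lower score of the best action. The two means thus differ by at most two
    -- widths of layer `k`.
    · have hkL : k ≤ c.L := by omega
      rw [hk] at hact hmem hwide
      have n1 := hnarrow k (by omega) a hmem.1
      have n2 := hnarrow k (by omega) (h.act t) hact.1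
      have n3 := hact.2 a hmem.1
      have c1 := hci k hkL a
      have c2 := hci k hkL (h.act t)
      rw [width] at n1 n2
      rw [pow_succ] at hwide
      linarith [c1.1, c1.2, c2.1, c2.2]

/-! ### Summation over rounds -/

lemma hist_mono {s t : ℕ} (hst : s ≤ t) : h.hist s l ⊆ h.hist t l :=
  Finset.filter_subset_filter _ (Finset.range_mono hst)

lemma det_pool_mono {s t : ℕ} (hst : s ≤ t) :
    (h.A s l + h.Goff).det ≤ (h.A t l + h.Goff).det := by
  have e : h.A t l + h.Goff = h.A s l + h.Goff +
      ∑ i ∈ h.hist t l \ h.hist s l, vecMulVec (h.played i) (h.played i) := by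
    rw [A, A, ← Finset.sum_sdiff (hist_mono (h := h) (l := l) hst)]
    abel
  rw [e]
  exact det_le_det_add (h.posDef_pool s l) _ _

lemma det_Goff_le (t l : ℕ) : h.Goff.det ≤ (h.A t l + h.Goff).det := by
  rw [add_comm]
  exact det_le_det_add h.posDef_Goff _ _

lemma Lam_le_LamMax (hl : l ≤ c.L) : h.Lam c l ≤ h.LamMax c :=
  le_ciSup (f := fun l : Fin (c.L + 1) => h.Lam c l) (Set.finite_range _).bddAbove
    ⟨l, Nat.lt_succ_of_le hl⟩

lemma δpoolMin_pos (hc : c.Admissible) : 0 < c.δpoolMin := by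
  -- `T ≥ 1` matters here: the infimum over an empty index set would be `0`.
  have : Nonempty (Fin c.T × Fin (c.L + 1)) := ⟨⟨⟨0, hc.one_le_T⟩, 0⟩⟩
  obtain ⟨p, hp⟩ := exists_eq_ciInf_of_finite (f := fun p : Fin c.T × Fin (c.L + 1) =>
    c.δpool p.1 p.2)
  rw [Config.δpoolMin, ← hp]
  exact hc.δpool_pos _ p.1.2 _ (Nat.le_of_lt_succ p.2.2)

lemma δpoolMin_le (ht : t < c.T) (hl : l ≤ c.L) : c.δpoolMin ≤ c.δpool t l :=
  ciInf_le (f := fun p : Fin c.T × Fin (c.L + 1) => c.δpool p.1 p.2)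
    (Set.finite_range _).bddBelow ⟨⟨t, ht⟩, ⟨l, Nat.lt_succ_of_le hl⟩⟩

/-- The log-determinant of a layer only grows with time, so its value before round `t` is at most
its final value, hence at most `LamMax`. Taking the square root of the determinant inside the
logarithm absorbs the factor 2. -/
lemma gammaPool_add_betaOff_le (hc : c.Admissible) (ht : t < c.T) (hl : l ≤ c.L) :
    h.gammaPool c t l + h.betaOff c ≤ h.GammaPool c := by
  rw [GammaPool, add_comm]
  refine add_le_add le_rfl (mul_le_mul_of_nonneg_left (Real.sqrt_le_sqrt ?_) hc.σ_nonneg)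
  have hG := h.posDef_Goff.det_pos
  have hQ := (h.posDef_pool t l).det_pos
  have hQT := (h.posDef_pool c.T l).det_pos
  have hδ := hc.δpool_pos t ht l hl
  have hm := δpoolMin_pos hc
  rw [Real.log_div (by positivity) (by positivity), Real.log_mul (by positivity) hδ.ne',
    Real.log_sqrt hQ.le, Real.log_sqrt hG.le, one_div, Real.log_inv]
  have h1 := Lam_le_LamMax (h := h) hl
  rw [Lam, Real.log_div hQT.ne' hG.ne'] at h1
  have h2 := Real.log_le_log hQ (det_pool_mono (h := h) (l := l) ht.le)
  have h3 := Real.log_le_log hm (δpoolMin_le ht hl)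
  linarith

/-- Elliptical potential as an exact telescoping identity: by the rank-one determinant formula each
round of the layer multiplies `det (A + G)` by its summand's argument, and all other rounds leave it
unchanged. -/
lemma sum_log_one_add (t l : ℕ) :
    ∑ s ∈ h.hist t l, Real.log (1 + mnorm (h.A s l + h.Goff)⁻¹ (h.played s) ^ 2) =
      Real.log ((h.A t l + h.Goff).det / h.Goff.det) := by
  have hG := h.posDef_Goff.det_pos
  induction t with
  | zero => simp [hist, A, hG.ne']
  | succ t ih =>
    by_cases hl : h.layer t = l
    · have e : h.hist (t + 1) l = insert t (h.hist t l) := by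
        simp [hist, Finset.range_add_one, Finset.filter_insert, hl]
      have hn : t ∉ h.hist t l := by simp [hist]
      have hQ := h.posDef_pool t l
      have hq := quadForm_nonneg hQ.inv.posSemidef (h.played t)
      have hd := hQ.det_pos
      have e2 : h.A (t + 1) l + h.Goff =
          h.A t l + h.Goff + vecMulVec (h.played t) (h.played t) := by
        rw [A, e, Finset.sum_insert hn, A]; abel
      rw [e, Finset.sum_insert hn, ih, e2, det_add_vecMulVec hQ, mnorm_sq hQ.inv.posSemidef,
        mul_div_right_comm, Real.log_mul (by positivity) (by positivity), add_comm]
    · have e : h.hist (t + 1) l = h.hist t l := by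
        simp [hist, Finset.range_add_one, Finset.filter_insert, hl]
      rw [e, ih, A, A, e]

/-- From `log (1 + q) ≥ q / (1 + q) ≥ q / 2`. -/
lemma le_two_mul_log_one_add {q : ℝ} (h0 : 0 ≤ q) (h1 : q ≤ 1) : q ≤ 2 * Real.log (1 + q) := by
  have h := Real.one_sub_inv_le_log_of_pos (show 0 < 1 + q by positivity)
  have : q / 2 ≤ 1 - (1 + q)⁻¹ := by
    rw [← sub_nonneg]
    have : 1 - (1 + q)⁻¹ - q / 2 = q * (1 - q) / (2 * (1 + q)) := by field_simp; ring
    rw [this]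
    exact div_nonneg (mul_nonneg h0 (by linarith)) (by positivity)
  linarith

/-- Rounds are grouped by stopping layer. Each squared norm is at most 1 because `A + G ⪰ 1` and
features have length at most 1, so it is at most twice the logarithm that telescopes. -/
lemma sum_sq_mnorm_le (hx : ∀ t < c.T, l2norm (h.played t) ≤ 1)
    (hlayer : ∀ t < c.T, h.layer t ≤ c.L) :
    ∑ t ∈ Finset.range c.T, mnorm (h.A t (h.layer t) + h.Goff)⁻¹ (h.played t) ^ 2
      ≤ 2 * h.LamSum c := by
  have hm : ∀ t ∈ Finset.range c.T, h.layer t ∈ Finset.range (c.L + 1) := fun t ht =>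
    Finset.mem_range.2 (Nat.lt_succ_of_le (hlayer t (Finset.mem_range.1 ht)))
  rw [← Finset.sum_fiberwise_of_maps_to hm, LamSum, Finset.mul_sum]
  refine Finset.sum_le_sum fun l _ => ?_
  rw [Lam, ← sum_log_one_add, Finset.mul_sum]
  refine Finset.sum_le_sum fun s hs => ?_
  obtain ⟨hsT, hsl⟩ := Finset.mem_filter.1 hs
  rw [hsl]
  refine le_two_mul_log_one_add (sq_nonneg _) ?_
  have h1 := (h.mnorm_pool_inv_le s l (h.played s)).trans (hx s (Finset.mem_range.1 hsT))
  exact pow_le_one₀ (mnorm_nonneg _ _) h1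

lemma sum_mnorm_le (hx : ∀ t < c.T, l2norm (h.played t) ≤ 1)
    (hlayer : ∀ t < c.T, h.layer t ≤ c.L) :
    ∑ t ∈ Finset.range c.T, mnorm (h.A t (h.layer t) + h.Goff)⁻¹ (h.played t)
      ≤ Real.sqrt (2 * c.T * h.LamSum c) := by
  apply Real.le_sqrt_of_sq_le
  refine sq_sum_le_card_mul_sum_sq.trans ?_
  rw [Finset.card_range]
  have := mul_le_mul_of_nonneg_left (sum_sq_mnorm_le hx hlayer) (Nat.cast_nonneg (α := ℝ) c.T)
  linarith

lemma GammaPool_nonneg (hc : c.Admissible) (hS : 0 ≤ c.S) : 0 ≤ h.GammaPool c := by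
  have := hc.σ_nonneg
  rw [GammaPool, betaOff]
  positivity

lemma regret_le_pooledTerm {θ θd : Fin d → ℝ} (hc : c.Admissible)
    (hcert : c.ValidCertificate θ θd) (hθ : l2norm θ ≤ c.S)
    (hx : ∀ t < c.T, ∀ a, l2norm (h.x t a) ≤ 1)
    (hmean : ∀ t < c.T, ∀ a, h.x t a ⬝ᵥ θ ∈ Set.Icc (0 : ℝ) 1)
    (hrun : h.IsRun c) (hgood : h.Good c θ θd) : h.regret c θ ≤ h.pooledTerm c := by
  have hG := GammaPool_nonneg (h := h) hc ((Real.sqrt_nonneg _).trans hθ)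
  have hsum := sum_mnorm_le (h := h) (fun t ht => hx t ht _) (fun t ht => (hrun t ht).1)
  calc h.regret c θ
      ≤ ∑ t ∈ Finset.range c.T,
          (8 * h.GammaPool c * mnorm (h.A t (h.layer t) + h.Goff)⁻¹ (h.played t)
            + 8 * c.ρ * h.psi c t (h.layer t) (h.played t)) := by
        refine Finset.sum_le_sum fun t ht => ?_
        rw [Finset.mem_range] at ht
        refine (round_regret_le hcert hθ (hmean t ht) hrun hgood ht).trans ?_
        have := mul_le_mul_of_nonneg_right
          (gammaPool_add_betaOff_le (h := h) hc ht (hrun t ht).1)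
          (mnorm_nonneg (h.A t (h.layer t) + h.Goff)⁻¹ (h.played t))
        rw [radPool]
        linarith
    _ ≤ h.pooledTerm c := by
        rw [Finset.sum_add_distrib, ← Finset.mul_sum, ← Finset.mul_sum, pooledTerm, PsiSum]
        have := mul_le_mul_of_nonneg_left hsum (show 0 ≤ 8 * h.GammaPool c by positivity)
        linarith

/-! ### Alignment -/

/-- With `w = (A + G)⁻¹ x` and `g = G^{1/2} w`, the square of `psi` is the quadratic form of
`G^{1/2} M⁻¹ G^{1/2}` at `g`, hence at most `cAlign · ‖g‖²`. Moreover `‖g‖² = w·Gw ≤ w·(A + G)w`,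
the squared norm on the right. -/
lemma psi_le (hM : c.M.PosDef) (t l : ℕ) (x : Fin d → ℝ) :
    h.psi c t l x ≤ Real.sqrt (h.cAlign c) * mnorm (h.A t l + h.Goff)⁻¹ x := by
  have hG := h.posDef_Goff
  have hQ := h.posDef_pool t l
  set w := (h.A t l + h.Goff)⁻¹ *ᵥ x with hw
  set g := msqrt h.Goff *ᵥ w with hg
  set B := msqrt h.Goff * c.M⁻¹ * msqrt h.Goff with hB
  have hBpsd : B.PosSemidef := by
    have := hM.inv.posSemidef.mul_mul_conjTranspose_same (msqrt h.Goff)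
    rwa [(isHermitian_msqrt h.Goff).eq] at this
  have e : h.psi c t l x = mnorm B g := by
    rw [psi, ← mulVec_mulVec, ← mulVec_mulVec, ← hw, l2norm_msqrt_inv_mulVec hM, mnorm, mnorm]
    congr 1
    have e' : msqrt h.Goff *ᵥ g = h.Goff *ᵥ w := by
      rw [hg, mulVec_mulVec, msqrt_mul_self hG.posSemidef]
    rw [hB, ← mulVec_mulVec, ← mulVec_mulVec,
      dotProduct_mulVec_comm_of_isHermitian (isHermitian_msqrt h.Goff), e']
  have hgg : g ⬝ᵥ g ≤ mnorm (h.A t l + h.Goff)⁻¹ x ^ 2 := by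
    rw [mnorm_sq hQ.inv.posSemidef, hg,
      ← dotProduct_mulVec_comm_of_isHermitian (isHermitian_msqrt h.Goff), mulVec_mulVec,
      msqrt_mul_self hG.posSemidef, ← hw, dotProduct_comm x w]
    have h1 : (h.A t l + h.Goff) *ᵥ w = x := mulVec_inv_mulVec hQ x
    have h2 := congrArg (w ⬝ᵥ ·) h1
    simp only [add_mulVec, dotProduct_add] at h2
    linarith [quadForm_nonneg (h.posSemidef_A t l) w]
  have hray := quadForm_le_lambdaMax hBpsd.1 g
  have hgg0 : 0 ≤ g ⬝ᵥ g := by simpa using quadForm_nonneg PosSemidef.one g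
  rw [e, mnorm]
  calc Real.sqrt (g ⬝ᵥ (B *ᵥ g)) ≤ Real.sqrt (lambdaMax B * (g ⬝ᵥ g)) := Real.sqrt_le_sqrt hray
    _ = Real.sqrt (lambdaMax B) * Real.sqrt (g ⬝ᵥ g) := Real.sqrt_mul' _ hgg0
    _ ≤ _ := mul_le_mul_of_nonneg_left
        (Real.sqrt_le_iff.2 ⟨mnorm_nonneg _ _, hgg⟩) (Real.sqrt_nonneg _)

lemma pooledTerm_le_alignedPooledTerm (hM : c.M.PosDef) (hρ : 0 ≤ c.ρ)
    (hx : ∀ t < c.T, l2norm (h.played t) ≤ 1) (hlayer : ∀ t < c.T, h.layer t ≤ c.L) :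
    h.pooledTerm c ≤ h.alignedPooledTerm c := by
  have h1 : h.PsiSum c ≤ Real.sqrt (h.cAlign c) * Real.sqrt (2 * c.T * h.LamSum c) := by
    refine le_trans (Finset.sum_le_sum fun t _ => psi_le hM t (h.layer t) (h.played t)) ?_
    rw [← Finset.mul_sum]
    exact mul_le_mul_of_nonneg_left (sum_mnorm_le hx hlayer) (Real.sqrt_nonneg _)
  have := mul_le_mul_of_nonneg_left h1 hρ
  rw [pooledTerm, alignedPooledTerm]
  linarith

lemma alignedPooledTerm_le_fallback (hc : c.Admissible) (hS : 0 ≤ c.S) (hρ : 0 ≤ c.ρ) {C : ℝ}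
    (hC : 0 ≤ C)
    (hreg : h.LamSum c * (h.GammaPool c + c.ρ * Real.sqrt (h.cAlign c)) ^ 2 ≤
      C ^ 2 / 128 * d * c.logFactor K ^ 3) :
    h.alignedPooledTerm c ≤ fallback C c K := by
  have hG := GammaPool_nonneg (h := h) hc hS
  set X := h.GammaPool c + c.ρ * Real.sqrt (h.cAlign c) with hX
  have hX0 : 0 ≤ X := by positivity
  rw [alignedPooledTerm, fallback, ← hX, ← Real.sqrt_sq (show 0 ≤ 8 * X by positivity),
    ← Real.sqrt_mul (sq_nonneg _), ← Real.sqrt_sq hC, ← Real.sqrt_mul (sq_nonneg _)]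
  apply Real.sqrt_le_sqrt
  -- Under the square roots the claim is `(8X)² · 2TΛ ≤ C² T d L_T³`, which is the regime condition
  -- times `128 T`.
  have := mul_le_mul_of_nonneg_left hreg (show (0 : ℝ) ≤ 128 * c.T by positivity)
  linarith

end Trajectory

open ProbabilityTheory Filter Topology
open scoped ENNReal NNReal

/-! ### Exponential inequalities for conditionally sub-Gaussian noise. -/

section SubGaussian

variable {Ω : Type*} {m mΩ : MeasurableSpace Ω} {μ : Measure Ω} {X : Ω → ℝ} {σ : ℝ}

lemma CondSubGaussian.div_const (hX : CondSubGaussian μ m σ X) (hσ : 0 < σ) :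
    CondSubGaussian μ m 1 fun ω => X ω / σ := by
  intro u
  have h := hX (u / σ)
  have e : ∀ ω, u / σ * X ω = u * (X ω / σ) := fun ω => by ring
  have e2 : (u / σ) ^ 2 * σ ^ 2 / 2 = u ^ 2 * 1 ^ 2 / 2 := by field_simp
  simpa only [e, e2] using h

variable [IsProbabilityMeasure μ]

/-- The measure with density `exp (uX - u²/2)` is at most `μ` on every set of `m`, by the
conditional moment bound. Comparing integrals of the `m`-measurable weight `W` then needs no
integrability of `W`. -/
lemma CondSubGaussian.lintegral_mul_exp_le (hm : m ≤ mΩ) (hX : CondSubGaussian μ m 1 X)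
    (hXm : Measurable X) {W : Ω → ℝ≥0∞} (hW : Measurable[m] W) (u : ℝ) :
    ∫⁻ ω, W ω * ENNReal.ofReal (Real.exp (u * X ω - u ^ 2 / 2)) ∂μ ≤ ∫⁻ ω, W ω ∂μ := by
  obtain ⟨hint, hle⟩ := hX u
  set f : Ω → ℝ≥0∞ := fun ω => ENNReal.ofReal (Real.exp (u * X ω - u ^ 2 / 2)) with hf
  have hfm : Measurable f := by fun_prop
  have hint' : Integrable (fun ω => Real.exp (u * X ω - u ^ 2 / 2)) μ := by
    simp_rw [Real.exp_sub]
    exact hint.div_const _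
  have hν : (μ.withDensity f).trim hm ≤ μ.trim hm := by
    refine Measure.le_iff.2 fun s hs => ?_
    rw [trim_measurableSet_eq hm hs, trim_measurableSet_eq hm hs, withDensity_apply _ (hm s hs),
      ← ofReal_integral_eq_lintegral_ofReal hint'.integrableOn
        (ae_of_all _ fun ω => (Real.exp_pos _).le)]
    refine ENNReal.ofReal_le_of_le_toReal ?_
    simp_rw [Real.exp_sub]
    rw [integral_div, ← setIntegral_condExp hm hint hs, div_le_iff₀ (Real.exp_pos _)]
    calc ∫ ω in s, (μ[fun ω => Real.exp (u * X ω) | m]) ω ∂μ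
        ≤ ∫ _ in s, Real.exp (u ^ 2 / 2) ∂μ := by
          refine setIntegral_mono_ae integrable_condExp.integrableOn (integrable_const _).integrableOn
            ?_
          filter_upwards [hle] with ω hω
          simpa using hω
      _ = (μ s).toReal * Real.exp (u ^ 2 / 2) := by simp [Measure.real]
  calc ∫⁻ ω, W ω * f ω ∂μ = ∫⁻ ω, W ω ∂(μ.withDensity f) := by
        rw [lintegral_withDensity_eq_lintegral_mul _ hfm (hW.mono hm le_rfl)]
        simp [mul_comm]
    _ = ∫⁻ ω, W ω ∂((μ.withDensity f).trim hm) := (lintegral_trim hm hW).symm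
    _ ≤ ∫⁻ ω, W ω ∂(μ.trim hm) := lintegral_mono' hν le_rfl
    _ = ∫⁻ ω, W ω ∂μ := lintegral_trim hm hW

/-- A tilt with countably many values is constant on the cells of a countable `m`-measurable
partition; the fixed-tilt inequality is applied with the weight restricted to each cell. -/
lemma CondSubGaussian.lintegral_mul_exp_le_of_discrete (hm : m ≤ mΩ)
    (hX : CondSubGaussian μ m 1 X) (hXm : Measurable X) {W : Ω → ℝ≥0∞} (hW : Measurable[m] W)
    {g : Ω → ℤ} (hg : Measurable[m] g) (v : ℤ → ℝ) :
    ∫⁻ ω, W ω * ENNReal.ofReal (Real.exp (v (g ω) * X ω - v (g ω) ^ 2 / 2)) ∂μ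
      ≤ ∫⁻ ω, W ω ∂μ := by
  have hs : ∀ i : ℤ, MeasurableSet[m] (g ⁻¹' {i}) := fun i => hg (measurableSet_singleton i)
  have hd : Pairwise (Function.onFun Disjoint fun i : ℤ => g ⁻¹' {i}) :=
    fun i j hij => Disjoint.preimage g (Set.disjoint_singleton.2 hij)
  have hu : ⋃ i : ℤ, g ⁻¹' {i} = Set.univ := by ext; simp
  rw [← setLIntegral_univ, ← setLIntegral_univ W, ← hu,
    lintegral_iUnion (fun i => hm _ (hs i)) hd, lintegral_iUnion (fun i => hm _ (hs i)) hd]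
  refine ENNReal.tsum_le_tsum fun i => ?_
  rw [← lintegral_indicator (hm _ (hs i)), ← lintegral_indicator (hm _ (hs i))]
  refine le_trans (le_of_eq ?_)
    (hX.lintegral_mul_exp_le hm hXm (hW.indicator (hs i)) (v i))
  refine lintegral_congr fun ω => ?_
  by_cases h : ω ∈ g ⁻¹' {i}
  · have : g ω = i := h
    simp [this]
  · simp [Set.indicator_of_notMem h]

lemma tendsto_floor_mul_div (x : ℝ) :
    Tendsto (fun k : ℕ => (⌊x * (k + 1)⌋ : ℝ) / (k + 1)) atTop (𝓝 x) := by
  have h0 : Tendsto (fun k : ℕ => x - 1 / ((k : ℝ) + 1)) atTop (𝓝 x) := by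
    simpa using tendsto_const_nhds.sub (tendsto_one_div_add_atTop_nhds_zero_nat (𝕜 := ℝ))
  refine tendsto_of_tendsto_of_tendsto_of_le_of_le h0 tendsto_const_nhds (fun k => ?_)
    (fun k => ?_)
  · have hk : (0 : ℝ) < k + 1 := by positivity
    have := Int.sub_one_lt_floor (x * ((k : ℝ) + 1))
    change x - 1 / ((k : ℝ) + 1) ≤ _
    rw [le_div_iff₀ hk, sub_mul, one_div_mul_cancel hk.ne']
    exact this.le
  · have hk : (0 : ℝ) < k + 1 := by positivity
    change _ / ((k : ℝ) + 1) ≤ x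
    rw [div_le_iff₀ hk]
    exact Int.floor_le _

/-- The exponential supermartingale inequality with a predictable tilt. -/
lemma CondSubGaussian.lintegral_mul_exp_le_of_measurable (hm : m ≤ mΩ)
    (hX : CondSubGaussian μ m 1 X) (hXm : Measurable X) {W : Ω → ℝ≥0∞} (hW : Measurable[m] W)
    {lam : Ω → ℝ} (hlam : Measurable[m] lam) :
    ∫⁻ ω, W ω * ENNReal.ofReal (Real.exp (lam ω * X ω - lam ω ^ 2 / 2)) ∂μ
      ≤ ∫⁻ ω, W ω ∂μ := by
  -- The tilt is rounded down to multiples of `1 / (k + 1)`, the discrete case is applied, and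
  -- Fatou's lemma passes to the limit.
  set a : ℕ → Ω → ℝ := fun k ω => (⌊lam ω * (k + 1)⌋ : ℝ) / (k + 1) with ha
  have hg : ∀ k : ℕ, Measurable[m] fun ω => ⌊lam ω * (k + 1)⌋ := fun k =>
    Int.measurable_floor.comp (hlam.mul_const _)
  have ham : ∀ k, Measurable (a k) := fun k =>
    ((measurable_from_top.comp ((hg k).mono hm le_rfl)).div_const _)
  have hWm : Measurable W := hW.mono hm le_rfl
  have hlim : ∀ ω, Tendsto (fun k => W ω * ENNReal.ofReal
      (Real.exp (a k ω * X ω - a k ω ^ 2 / 2))) atTop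
      (𝓝 (W ω * ENNReal.ofReal (Real.exp (lam ω * X ω - lam ω ^ 2 / 2)))) := by
    intro ω
    have h1 : Tendsto (fun k => a k ω) atTop (𝓝 (lam ω)) := tendsto_floor_mul_div (lam ω)
    have hc : Continuous fun y : ℝ => Real.exp (y * X ω - y ^ 2 / 2) := by fun_prop
    refine ENNReal.Tendsto.const_mul (ENNReal.tendsto_ofReal ((hc.tendsto _).comp h1)) (Or.inl ?_)
    exact (ENNReal.ofReal_pos.2 (Real.exp_pos _)).ne'
  calc ∫⁻ ω, W ω * ENNReal.ofReal (Real.exp (lam ω * X ω - lam ω ^ 2 / 2)) ∂μ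
      = ∫⁻ ω, liminf (fun k => W ω * ENNReal.ofReal
          (Real.exp (a k ω * X ω - a k ω ^ 2 / 2))) atTop ∂μ :=
        lintegral_congr fun ω => (hlim ω).liminf_eq.symm
    _ ≤ liminf (fun k => ∫⁻ ω, W ω * ENNReal.ofReal
          (Real.exp (a k ω * X ω - a k ω ^ 2 / 2)) ∂μ) atTop := by
        refine lintegral_liminf_le fun k => ?_
        have := ham k
        fun_prop
    _ ≤ liminf (fun _ : ℕ => ∫⁻ ω, W ω ∂μ) atTop :=
        liminf_le_liminf <| Eventually.of_forall fun k =>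
          hX.lintegral_mul_exp_le_of_discrete hm hXm hW (hg k) fun i => (i : ℝ) / (k + 1)
    _ = ∫⁻ ω, W ω ∂μ := liminf_const _

/-- Gaussian mixture of exponential tilts with mean `p` and variance `q`. -/
lemma lintegral_gaussianPDF_mul_exp {q : ℝ} (hq : 0 ≤ q) (p x : ℝ) :
    ∫⁻ z, gaussianPDF 0 1 z *
        ENNReal.ofReal (Real.exp ((p + √q * z) * x - (p + √q * z) ^ 2 / 2)) =
      ENNReal.ofReal ((√(1 + q))⁻¹ *
        Real.exp ((q * x ^ 2 + 2 * p * x - p ^ 2) / (2 * (1 + q)))) := by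
  have hq1 : 0 < 1 + q := by positivity
  -- Completing the square in `z`: its coefficient is `√q (x - p)` and the quadratic part is `-(1 +
  -- q) z² / 2`, so `c` and `v` are the mean and variance of the resulting Gaussian.
  set c : ℝ := √q * (x - p) / (1 + q) with hc
  set v : ℝ≥0 := ⟨(1 + q)⁻¹, by positivity⟩ with hv
  have hvr : (v : ℝ) = (1 + q)⁻¹ := rfl
  have hv0 : v ≠ 0 := by
    intro h
    have : (v : ℝ) = 0 := by rw [h]; rfl
    rw [hvr] at this
    exact (inv_pos.2 hq1).ne' this
  have key : ∀ z : ℝ, gaussianPDF 0 1 z *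
      ENNReal.ofReal (Real.exp ((p + √q * z) * x - (p + √q * z) ^ 2 / 2)) =
      ENNReal.ofReal ((√(1 + q))⁻¹ *
        Real.exp ((q * x ^ 2 + 2 * p * x - p ^ 2) / (2 * (1 + q)))) * gaussianPDF c v z := by
    intro z
    rw [gaussianPDF, gaussianPDF, ← ENNReal.ofReal_mul (gaussianPDFReal_nonneg _ _ _),
      ← ENNReal.ofReal_mul (by positivity)]
    congr 1
    rw [gaussianPDFReal, gaussianPDFReal, hvr, Real.sqrt_mul (by positivity),
      Real.sqrt_mul (by positivity) (1 + q)⁻¹, Real.sqrt_inv]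
    have e1 : -(z - 0) ^ 2 / (2 * ((1 : ℝ≥0) : ℝ)) + ((p + √q * z) * x - (p + √q * z) ^ 2 / 2) =
        (q * x ^ 2 + 2 * p * x - p ^ 2) / (2 * (1 + q)) + -(z - c) ^ 2 / (2 * (1 + q)⁻¹) := by
      have hs : √q ^ 2 = q := Real.sq_sqrt hq
      have hs' : q = √q ^ 2 := hs.symm
      rw [hc]
      set s := √q
      rw [hs'] at hq1 ⊢
      have := hq1.ne'
      push_cast
      field_simp
      ring
    have e2 : √(1 + q) ≠ 0 := (Real.sqrt_pos.2 hq1).ne'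
    have e3 := congrArg Real.exp e1
    rw [Real.exp_add, Real.exp_add] at e3
    simp only [NNReal.coe_one, Real.sqrt_one, mul_one, mul_inv, inv_inv] at e3 ⊢
    rw [mul_assoc, e3]
    field_simp
  simp_rw [key]
  rw [lintegral_const_mul _ (measurable_gaussianPDF c v), lintegral_gaussianPDF_eq_one c hv0,
    mul_one]

/-- One step of the mixture supermartingale. -/
lemma CondSubGaussian.lintegral_mul_mixture_le (hm : m ≤ mΩ)
    (hX : CondSubGaussian μ m 1 X) (hXm : Measurable X) {W : Ω → ℝ≥0∞} (hW : Measurable[m] W)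
    {p q : Ω → ℝ} (hp : Measurable[m] p) (hq : Measurable[m] q) (hq0 : ∀ ω, 0 ≤ q ω) :
    ∫⁻ ω, W ω * ENNReal.ofReal ((√(1 + q ω))⁻¹ *
        Real.exp ((q ω * X ω ^ 2 + 2 * p ω * X ω - p ω ^ 2) / (2 * (1 + q ω)))) ∂μ
      ≤ ∫⁻ ω, W ω ∂μ := by
  have hpm : Measurable p := hp.mono hm le_rfl
  have hqm : Measurable q := hq.mono hm le_rfl
  have hWm : Measurable W := hW.mono hm le_rfl
  set F : Ω → ℝ → ℝ≥0∞ := fun ω z =>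
    ENNReal.ofReal (Real.exp ((p ω + √(q ω) * z) * X ω - (p ω + √(q ω) * z) ^ 2 / 2)) with hF
  have hFm : Measurable (Function.uncurry F) := by
    have : Function.uncurry F = fun y : Ω × ℝ => ENNReal.ofReal (Real.exp
      ((p y.1 + √(q y.1) * y.2) * X y.1 - (p y.1 + √(q y.1) * y.2) ^ 2 / 2)) := rfl
    rw [this]
    fun_prop
  have hFz : ∀ z, Measurable fun ω => F ω z := fun z =>
    hFm.comp (measurable_id.prodMk measurable_const)
  have hFω : ∀ ω, Measurable (F ω) := fun ω => hFm.comp (measurable_const.prodMk measurable_id)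
  have hpdf : Measurable (gaussianPDF 0 1) := measurable_gaussianPDF 0 1
  calc ∫⁻ ω, W ω * ENNReal.ofReal ((√(1 + q ω))⁻¹ *
        Real.exp ((q ω * X ω ^ 2 + 2 * p ω * X ω - p ω ^ 2) / (2 * (1 + q ω)))) ∂μ
      = ∫⁻ ω, (∫⁻ z, gaussianPDF 0 1 z * (W ω * F ω z)) ∂μ := by
        refine lintegral_congr fun ω => ?_
        rw [← lintegral_gaussianPDF_mul_exp (hq0 ω),
          ← lintegral_const_mul _ (show Measurable fun z => gaussianPDF 0 1 z * F ω z from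
            hpdf.mul (hFω ω))]
        refine lintegral_congr fun z => ?_
        simp only [hF]
        ring
    -- By Tonelli, `z` may be fixed first; the tilt `p + √q z` is then `m`-measurable.
    _ = ∫⁻ z, ∫⁻ ω, gaussianPDF 0 1 z * (W ω * F ω z) ∂μ := by
        refine lintegral_lintegral_swap (Measurable.aemeasurable ?_)
        exact (hpdf.comp measurable_snd).mul ((hWm.comp measurable_fst).mul hFm)
    _ ≤ ∫⁻ z, gaussianPDF 0 1 z * ∫⁻ ω, W ω ∂μ := by
        refine lintegral_mono fun z => ?_
        have hWF : Measurable fun ω => W ω * F ω z := hWm.mul (hFz z)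
        rw [lintegral_const_mul _ hWF]
        refine mul_le_mul_right ?_ _
        refine hX.lintegral_mul_exp_le_of_measurable hm hXm hW
          (lam := fun ω => p ω + √(q ω) * z) ?_
        exact hp.add ((Real.continuous_sqrt.measurable.comp hq).mul_const z)
    _ = ∫⁻ ω, W ω ∂μ := by
        rw [lintegral_mul_const _ hpdf, lintegral_gaussianPDF_eq_one 0 one_ne_zero, one_mul]

/-- Conditionally `0`-sub-Gaussian variables vanish almost surely. -/
lemma CondSubGaussian.ae_eq_zero (hm : m ≤ mΩ) (hX : CondSubGaussian μ m 0 X) :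
    ∀ᵐ ω ∂μ, X ω = 0 := by
  have hle : ∀ u : ℝ, ∫ ω, Real.exp (u * X ω) ∂μ ≤ 1 := by
    intro u
    obtain ⟨-, h⟩ := hX u
    rw [← integral_condExp hm]
    calc ∫ ω, (μ[fun ω => Real.exp (u * X ω) | m]) ω ∂μ ≤ ∫ _, (1 : ℝ) ∂μ := by
          refine integral_mono_ae integrable_condExp (integrable_const _) ?_
          filter_upwards [h] with ω hω
          simpa using hω
      _ = 1 := by simp
  have i1 := (hX 1).1
  have i2 := (hX (-1)).1
  -- The integrand is `2 (cosh X - 1) ≥ 0`, which vanishes only where `X = 0`; the moment bounds at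
  -- `u = ±1` force its integral to be zero.
  have h0 : ∀ ω, 0 ≤ Real.exp (1 * X ω) + Real.exp (-1 * X ω) - 2 := by
    intro ω
    have := Real.one_le_cosh (X ω)
    rw [Real.cosh_eq] at this
    simp only [one_mul, neg_mul]
    linarith
  have hadd : Integrable (fun ω => Real.exp (1 * X ω) + Real.exp (-1 * X ω)) μ := i1.add i2
  have hint : Integrable (fun ω => Real.exp (1 * X ω) + Real.exp (-1 * X ω) - 2) μ :=
    hadd.sub (integrable_const _)
  have hz : ∫ ω, (Real.exp (1 * X ω) + Real.exp (-1 * X ω) - 2) ∂μ = 0 := by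
    refine le_antisymm ?_ (integral_nonneg h0)
    rw [integral_sub hadd (integrable_const _), integral_add i1 i2]
    have h2 : ∫ _, (2 : ℝ) ∂μ = 2 := by simp
    linarith [hle 1, hle (-1)]
  filter_upwards [(integral_eq_zero_iff_of_nonneg h0 hint).1 hz] with ω hω
  by_contra hne
  have := Real.one_lt_cosh.2 hne
  rw [Real.cosh_eq] at this
  simp only [one_mul, neg_mul, Pi.zero_apply] at hω
  linarith

end SubGaussian

/-! ### Measurability of the matrix expressions, over an arbitrary σ-algebra. -/

section Measurability

variable {Ω : Type*} {m : MeasurableSpace Ω} {d : ℕ}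

lemma measurable_det {P : Ω → Matrix (Fin d) (Fin d) ℝ}
    (hP : ∀ i j, Measurable fun ω => P ω i j) : Measurable fun ω => (P ω).det := by
  simp_rw [det_apply]
  refine Finset.measurable_sum _ fun τ _ => ?_
  exact (Finset.measurable_prod _ fun i _ => hP _ _).const_smul _

/-- Cramer's rule: every entry is a polynomial in the entries divided by the determinant. Singular
matrices do no harm, since real inversion is measurable at `0` too. -/
lemma measurable_inv_apply {P : Ω → Matrix (Fin d) (Fin d) ℝ}
    (hP : ∀ i j, Measurable fun ω => P ω i j) (i j : Fin d) :
    Measurable fun ω => (P ω)⁻¹ i j := by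
  simp_rw [inv_def, Matrix.smul_apply, adjugate_apply, Ring.inverse_eq_inv', smul_eq_mul]
  refine (measurable_det hP).inv.mul (measurable_det fun k l => ?_)
  by_cases hk : k = j
  · subst hk
    simp
  · simp only [updateRow_ne hk]
    exact hP k l

lemma measurable_dotProduct {v w : Ω → Fin d → ℝ} (hv : Measurable v) (hw : Measurable w) :
    Measurable fun ω => v ω ⬝ᵥ w ω :=
  Finset.measurable_sum _ fun i _ =>
    ((measurable_pi_apply i).comp hv).mul ((measurable_pi_apply i).comp hw)

lemma measurable_mulVec {P : Ω → Matrix (Fin d) (Fin d) ℝ} {v : Ω → Fin d → ℝ}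
    (hP : ∀ i j, Measurable fun ω => P ω i j) (hv : Measurable v) :
    Measurable fun ω => P ω *ᵥ v ω :=
  measurable_pi_lambda _ fun i => measurable_dotProduct (measurable_pi_lambda _ (hP i)) hv

lemma measurable_sum_vecMulVec_apply {P : Ω → Matrix (Fin d) (Fin d) ℝ} {φ : ℕ → Ω → Fin d → ℝ}
    {t : ℕ} (hP : ∀ i j, Measurable fun ω => P ω i j) (hφ : ∀ s < t, Measurable (φ s))
    (i j : Fin d) :
    Measurable fun ω => (P ω + ∑ s ∈ Finset.range t, vecMulVec (φ s ω) (φ s ω)) i j := by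
  simp only [Matrix.add_apply, Matrix.sum_apply, vecMulVec_apply]
  refine (hP i j).add (Finset.measurable_sum _ fun s hs => ?_)
  have h := hφ s (Finset.mem_range.1 hs)
  exact ((measurable_pi_apply i).comp h).mul ((measurable_pi_apply j).comp h)

lemma measurable_sum_smul {η : ℕ → Ω → ℝ} {φ : ℕ → Ω → Fin d → ℝ} {t : ℕ}
    (hη : ∀ s < t, Measurable (η s)) (hφ : ∀ s < t, Measurable (φ s)) :
    Measurable fun ω => ∑ s ∈ Finset.range t, η s ω • φ s ω :=
  Finset.measurable_sum _ fun s hs =>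
    (hη s (Finset.mem_range.1 hs)).smul (hφ s (Finset.mem_range.1 hs))

end Measurability

/-! ### The mixture supermartingale and the self-normalized tail bound. -/

section SelfNormalized

variable {Ω : Type*} {d : ℕ}

/-- The self-normalized exponential process with prior precision `P`. -/
noncomputable def mixtureProcess (P : Ω → Matrix (Fin d) (Fin d) ℝ) (φ : ℕ → Ω → Fin d → ℝ)
    (η : ℕ → Ω → ℝ) (t : ℕ) (ω : Ω) : ℝ :=
  (√((P ω + ∑ s ∈ Finset.range t, vecMulVec (φ s ω) (φ s ω)).det / (P ω).det))⁻¹ *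
    Real.exp (((∑ s ∈ Finset.range t, η s ω • φ s ω) ⬝ᵥ
      ((P ω + ∑ s ∈ Finset.range t, vecMulVec (φ s ω) (φ s ω))⁻¹ *ᵥ
        (∑ s ∈ Finset.range t, η s ω • φ s ω))) / 2)

variable {P : Ω → Matrix (Fin d) (Fin d) ℝ} {φ : ℕ → Ω → Fin d → ℝ} {η : ℕ → Ω → ℝ}

lemma mixtureProcess_nonneg (t : ℕ) (ω : Ω) : 0 ≤ mixtureProcess P φ η t ω := by
  rw [mixtureProcess]; positivity

lemma measurable_mixtureProcess {m : MeasurableSpace Ω} {t : ℕ}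
    (hP : ∀ i j, Measurable fun ω => P ω i j) (hφ : ∀ s < t, Measurable (φ s))
    (hη : ∀ s < t, Measurable (η s)) : Measurable (mixtureProcess P φ η t) := by
  have h1 := measurable_sum_vecMulVec_apply hP hφ
  have h2 := measurable_sum_smul hη hφ
  exact (((measurable_det h1).div (measurable_det hP)).sqrt.inv).mul
    ((measurable_dotProduct h2 (measurable_mulVec (measurable_inv_apply h1) h2)).div_const 2).exp

/-- The new factor is exactly the Gaussian average of tilts with mean `p = φᵀQ⁻¹S` and variance `q =
φᵀQ⁻¹φ`, where `Q` and `S` are the precision matrix and weighted sum of the past: the law of the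
tilt in direction `φ` under the Gaussian with mean `Q⁻¹S` and covariance `Q⁻¹`. -/
lemma mixtureProcess_succ (hP : ∀ ω, (P ω).PosDef) (t : ℕ) (ω : Ω) :
    mixtureProcess P φ η (t + 1) ω = mixtureProcess P φ η t ω *
      ((√(1 + φ t ω ⬝ᵥ ((P ω + ∑ s ∈ Finset.range t, vecMulVec (φ s ω) (φ s ω))⁻¹ *ᵥ φ t ω)))⁻¹ *
        Real.exp (((φ t ω ⬝ᵥ
          ((P ω + ∑ s ∈ Finset.range t, vecMulVec (φ s ω) (φ s ω))⁻¹ *ᵥ φ t ω)) * η t ω ^ 2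
          + 2 * (φ t ω ⬝ᵥ ((P ω + ∑ s ∈ Finset.range t, vecMulVec (φ s ω) (φ s ω))⁻¹ *ᵥ
              (∑ s ∈ Finset.range t, η s ω • φ s ω))) * η t ω
          - (φ t ω ⬝ᵥ ((P ω + ∑ s ∈ Finset.range t, vecMulVec (φ s ω) (φ s ω))⁻¹ *ᵥ
              (∑ s ∈ Finset.range t, η s ω • φ s ω))) ^ 2) /
          (2 * (1 + φ t ω ⬝ᵥ
            ((P ω + ∑ s ∈ Finset.range t, vecMulVec (φ s ω) (φ s ω))⁻¹ *ᵥ φ t ω))))) := by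
  have hQ := (hP ω).add_posSemidef
    (posSemidef_sum_vecMulVec (Finset.range t) fun s => φ s ω)
  have hq := quadForm_nonneg hQ.inv.posSemidef (φ t ω)
  have hd := hQ.det_pos
  have hd0 := (hP ω).det_pos
  rw [mixtureProcess, mixtureProcess, Finset.sum_range_succ, Finset.sum_range_succ, ← add_assoc,
    inv_quadForm_update hQ, det_add_vecMulVec hQ, mul_div_right_comm,
    Real.sqrt_mul (by positivity), mul_inv, add_div, Real.exp_add, div_div, mul_comm _ (2 : ℝ)]
  ring

variable {mΩ : MeasurableSpace Ω} {μ : Measure Ω} [IsProbabilityMeasure μ]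

/-- The process starts at 1, and its expectation does not increase, because the parameters of each
mixture step are known before the noise. The σ-algebras need not be nested: `m t` only has to
contain the prior, the past noises and the features up to time `t`. -/
lemma lintegral_mixtureProcess_le {m : ℕ → MeasurableSpace Ω} {N : ℕ}
    (hm : ∀ t < N, m t ≤ mΩ) (hP : ∀ ω, (P ω).PosDef)
    (hPm : ∀ t < N, ∀ i j, Measurable[m t] fun ω => P ω i j)
    (hφ : ∀ t < N, ∀ s ≤ t, Measurable[m t] (φ s))
    (hη : ∀ t < N, ∀ s < t, Measurable[m t] (η s)) (hηm : ∀ t < N, Measurable (η t))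
    (hsub : ∀ t < N, CondSubGaussian μ (m t) 1 (η t)) {t : ℕ} (ht : t ≤ N) :
    ∫⁻ ω, ENNReal.ofReal (mixtureProcess P φ η t ω) ∂μ ≤ 1 := by
  induction t with
  | zero =>
    have : ∀ ω, mixtureProcess P φ η 0 ω = 1 := fun ω => by
      simp [mixtureProcess, (hP ω).det_pos.ne']
    simp [this]
  | succ t ih =>
    refine le_trans ?_ (ih (by omega))
    simp_rw [mixtureProcess_succ hP, ENNReal.ofReal_mul (mixtureProcess_nonneg _ _)]
    have hφt : ∀ s < t, Measurable[m t] (φ s) := fun s hs => hφ t ht s hs.le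
    have h1 := measurable_inv_apply (measurable_sum_vecMulVec_apply (hPm t ht) hφt)
    refine (hsub t ht).lintegral_mul_mixture_le (hm t ht) (hηm t ht)
      (ENNReal.measurable_ofReal.comp (measurable_mixtureProcess (hPm t ht) hφt (hη t ht)))
      (measurable_dotProduct (hφ t ht t le_rfl)
        (measurable_mulVec h1 (measurable_sum_smul (hη t ht) hφt)))
      (measurable_dotProduct (hφ t ht t le_rfl) (measurable_mulVec h1 (hφ t ht t le_rfl)))
      fun ω => ?_
    exact quadForm_nonneg ((hP ω).add_posSemidef
      (posSemidef_sum_vecMulVec (Finset.range t) fun s => φ s ω)).inv.posSemidef _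

/-- Self-normalized tail bound with a random prior precision matrix. -/
lemma measure_mnorm_gt_le {m : ℕ → MeasurableSpace Ω} {N : ℕ} {σ δ : ℝ} (hσ : 0 ≤ σ)
    (hδ : 0 < δ) (hm : ∀ t < N, m t ≤ mΩ) (hP : ∀ ω, (P ω).PosDef)
    (hPΩ : ∀ i j, Measurable fun ω => P ω i j)
    (hPm : ∀ t < N, ∀ i j, Measurable[m t] fun ω => P ω i j)
    (hφ : ∀ t < N, ∀ s ≤ t, Measurable[m t] (φ s))
    (hη : ∀ t < N, ∀ s < t, Measurable[m t] (η s)) (hηm : ∀ t < N, Measurable (η t))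
    (hsub : ∀ t < N, CondSubGaussian μ (m t) σ (η t)) :
    μ {ω | ¬ mnorm (P ω + ∑ s ∈ Finset.range N, vecMulVec (φ s ω) (φ s ω))⁻¹
        (∑ s ∈ Finset.range N, η s ω • φ s ω) ≤
      σ * √(2 * Real.log (√(P ω + ∑ s ∈ Finset.range N, vecMulVec (φ s ω) (φ s ω)).det /
        (√(P ω).det * δ)))} ≤ ENNReal.ofReal δ := by
  -- The noise is normalized by `σ` below, so `σ = 0` is separate: then the noise vanishes almost
  -- surely.
  rcases hσ.eq_or_lt with rfl | hσ
  · have h0 : ∀ᵐ ω ∂μ, ∀ s, s < N → η s ω = 0 :=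
      ae_all_iff.2 fun s => by
        by_cases hs : s < N
        · filter_upwards [(hsub s hs).ae_eq_zero (hm s hs)] with ω hω _ using hω
        · exact ae_of_all _ fun ω h => absurd h hs
    refine (measure_mono_null ?_ h0).le.trans zero_le
    intro ω hω hzero
    refine hω ?_
    have hS : ∑ s ∈ Finset.range N, η s ω • φ s ω = 0 :=
      Finset.sum_eq_zero fun s hs => by
        rw [(show ∀ s < N, η s ω = 0 from hzero) s (Finset.mem_range.1 hs), zero_smul]
    simp [hS, mnorm]
  · set ε : ℕ → Ω → ℝ := fun s ω => η s ω / σ with hε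
    have hφN : ∀ s < N, Measurable (φ s) := fun s hs => (hφ s hs s le_rfl).mono (hm s hs) le_rfl
    have hεN : ∀ s < N, Measurable (ε s) := fun s hs => (hηm s hs).div_const σ
    have hint : ∫⁻ ω, ENNReal.ofReal (mixtureProcess P φ ε N ω) ∂μ ≤ 1 :=
      lintegral_mixtureProcess_le hm hP hPm hφ (fun t ht s hs => (hη t ht s hs).div_const σ) hεN
        (fun t ht => (hsub t ht).div_const hσ) le_rfl
    have hmeas : AEMeasurable (fun ω => ENNReal.ofReal (mixtureProcess P φ ε N ω)) μ :=
      (measurable_mixtureProcess hPΩ hφN hεN).ennreal_ofReal.aemeasurable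
    -- Markov at level `1/δ`: failure of the norm bound, after squaring and exponentiating, says
    -- that the process is at least `1/δ`.
    have hmarkov := meas_ge_le_lintegral_div hmeas (ε := ENNReal.ofReal δ⁻¹)
      (ENNReal.ofReal_pos.2 (inv_pos.2 hδ)).ne' ENNReal.ofReal_ne_top
    refine (measure_mono ?_).trans (hmarkov.trans ?_)
    · intro ω hω
      refine ENNReal.ofReal_le_ofReal ?_
      have hQ := (hP ω).add_posSemidef
        (posSemidef_sum_vecMulVec (Finset.range N) fun s => φ s ω)
      have hd := hQ.det_pos
      have hd0 := (hP ω).det_pos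
      have hS : ∑ s ∈ Finset.range N, η s ω • φ s ω =
          σ • ∑ s ∈ Finset.range N, ε s ω • φ s ω := by
        rw [Finset.smul_sum]
        refine Finset.sum_congr rfl fun s _ => ?_
        rw [smul_smul, hε, mul_div_cancel₀ _ hσ.ne']
      simp only [Set.mem_ofPred_eq, not_le, hS] at hω
      rw [mixtureProcess]
      set Q := P ω + ∑ s ∈ Finset.range N, vecMulVec (φ s ω) (φ s ω)
      set S := ∑ s ∈ Finset.range N, ε s ω • φ s ω
      have hn : mnorm Q⁻¹ (σ • S) = σ * mnorm Q⁻¹ S := by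
        rw [mnorm, mnorm, mulVec_smul, dotProduct_smul, smul_dotProduct, smul_smul, smul_eq_mul,
          Real.sqrt_mul (by positivity), Real.sqrt_mul_self hσ.le]
      rw [hn] at hω
      -- This holds whatever the sign of the radicand, so the logarithm need not be nonnegative.
      have h1 := Real.lt_sq_of_sqrt_lt (lt_of_mul_lt_mul_left hω hσ.le)
      rw [mnorm_sq hQ.inv.posSemidef] at h1
      have h2 : Real.log (√Q.det / (√(P ω).det * δ)) ≤ (S ⬝ᵥ (Q⁻¹ *ᵥ S)) / 2 := by linarith
      have h3 := Real.exp_le_exp.2 h2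
      rw [Real.exp_log (by positivity)] at h3
      refine le_trans (le_of_eq ?_) (mul_le_mul_of_nonneg_left h3 (by positivity))
      rw [Real.sqrt_div hd.le]
      have := Real.sqrt_pos.2 hd
      have := Real.sqrt_pos.2 hd0
      field_simp
    · refine (ENNReal.div_le_div_right hint _).trans (le_of_eq ?_)
      rw [one_div, ← ENNReal.ofReal_inv_of_pos (inv_pos.2 hδ), inv_inv]

end SelfNormalized

/-! ### The offline confidence ellipsoid. -/

section Offline

variable {K d n : ℕ} {Ω : Type*} {mΩ : MeasurableSpace Ω} {μ : Measure Ω}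
  {c : Config d} {θd : Fin d → ℝ} {H : Ω → Trajectory K d n}

lemma offlineInfo_le (hoff : OfflineModel μ c θd H) (i : Fin n) : offlineInfo H i ≤ mΩ :=
  sup_le (iSup_le fun j => (hoff.z_meas j).comap_le)
    (iSup_le fun j => iSup_le fun _ => (hoff.y_meas j).comap_le)

lemma measurable_offlineInfo_z (H : Ω → Trajectory K d n) (i j : Fin n) :
    Measurable[offlineInfo H i] fun ω => (H ω).z j :=
  Measurable.of_comap_le (le_sup_of_le_left
    (le_iSup (fun j => MeasurableSpace.comap (fun ω => (H ω).z j) inferInstance) j))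

lemma measurable_offlineInfo_y (H : Ω → Trajectory K d n) {i j : Fin n} (hj : j < i) :
    Measurable[offlineInfo H i] fun ω => (H ω).y j :=
  Measurable.of_comap_le (le_sup_of_le_right
    (le_iSup₂ (f := fun (j : Fin n) (_ : j < i) =>
      MeasurableSpace.comap (fun ω => (H ω).y j) inferInstance) j hj))

/-- The ridge error is `G⁻¹ (noise - θd)`, and `G ⪰ 1` bounds the regularization term by `‖θd‖₂`. -/
lemma Trajectory.mnorm_thetaOff_sub_le (h : Trajectory K d n) (θd : Fin d → ℝ) :
    mnorm h.Goff (h.thetaOff - θd) ≤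
      mnorm h.Goff⁻¹ (∑ i, (h.y i - h.z i ⬝ᵥ θd) • h.z i) + l2norm θd := by
  have hG := h.posDef_Goff
  have e : h.thetaOff - θd =
      h.Goff⁻¹ *ᵥ (∑ i, (h.y i - h.z i ⬝ᵥ θd) • h.z i - θd) := by
    have : ∑ i, (h.y i - h.z i ⬝ᵥ θd) • h.z i - θd = ∑ i, h.y i • h.z i - h.Goff *ᵥ θd := by
      simp only [Trajectory.Goff, add_mulVec, one_mulVec, sum_mulVec, vecMulVec_self_mulVec,
        sub_smul, Finset.sum_sub_distrib]
      abel
    rw [this, mulVec_sub, inv_mulVec_mulVec hG, Trajectory.thetaOff]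
  rw [e, mnorm_mulVec_inv hG]
  exact (mnorm_sub_le hG.inv.posSemidef _ _).trans (add_le_add le_rfl (h.mnorm_Goff_inv_le θd))

variable [IsProbabilityMeasure μ]

/-- The offline confidence ellipsoid fails with probability at most `δoff`. -/
lemma measure_offline_failure_le (hc : c.Admissible) (hoff : OfflineModel μ c θd H) :
    μ {ω | ¬ mnorm (H ω).Goff ((H ω).thetaOff - θd) ≤ (H ω).betaOff c}
      ≤ ENNReal.ofReal c.δoff := by
  -- Samples are reindexed by `ℕ`; the default values beyond `n` are never used, as the tail bound
  -- is taken at `N = n`.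
  set m : ℕ → MeasurableSpace Ω := fun s => if hs : s < n then offlineInfo H ⟨s, hs⟩ else ⊥
    with hm
  set φ : ℕ → Ω → Fin d → ℝ := fun s ω => if hs : s < n then (H ω).z ⟨s, hs⟩ else 0 with hφ
  set η : ℕ → Ω → ℝ := fun s ω =>
    if hs : s < n then (H ω).y ⟨s, hs⟩ - (H ω).z ⟨s, hs⟩ ⬝ᵥ θd else 0 with hη
  have hmt : ∀ t (ht : t < n), m t = offlineInfo H ⟨t, ht⟩ := fun t ht => dif_pos ht
  have hφt : ∀ t (ht : t < n), φ t = fun ω => (H ω).z ⟨t, ht⟩ := fun t ht => by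
    simp only [hφ, ht, dif_pos]
  have hηt : ∀ t (ht : t < n), η t = fun ω => (H ω).y ⟨t, ht⟩ - (H ω).z ⟨t, ht⟩ ⬝ᵥ θd :=
    fun t ht => by simp only [hη, ht, dif_pos]
  have key := measure_mnorm_gt_le (μ := μ) (P := fun _ => (1 : Matrix (Fin d) (Fin d) ℝ)) (φ := φ)
    (η := η) (m := m) (N := n) hc.σ_nonneg hc.δoff_pos
    (fun t ht => by rw [hmt t ht]; exact offlineInfo_le hoff _) (fun _ => PosDef.one)
    (fun _ _ => measurable_const) (fun _ _ _ _ => measurable_const)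
    (fun t ht s hs => by
      rw [hmt t ht, hφt s (by omega)]
      exact measurable_offlineInfo_z H _ _)
    (fun t ht s hs => by
      rw [hmt t ht, hηt s (by omega)]
      exact (measurable_offlineInfo_y H (Fin.mk_lt_mk.2 hs)).sub
        (measurable_dotProduct (measurable_offlineInfo_z H _ _) measurable_const))
    (fun t ht => by
      rw [hηt t ht]
      exact (hoff.y_meas _).sub (measurable_dotProduct (hoff.z_meas _) measurable_const))
    (fun t ht => by
      rw [hmt t ht, hηt t ht]
      exact (hoff.noise ⟨t, ht⟩).2)
  refine (measure_mono ?_).trans key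
  intro ω hω hle
  refine hω (((H ω).mnorm_thetaOff_sub_le θd).trans (add_le_add ?_ hoff.theta_le))
  rw [Finset.sum_range, Finset.sum_range] at hle
  simpa [hφ, hη, Trajectory.Goff] using hle

end Offline

/-! ### The online and pooled confidence bounds of a layer. -/

section Online

variable {K d n : ℕ} {Ω : Type*} {mΩ : MeasurableSpace Ω} {μ : Measure Ω}
  {c : Config d} {θ : Fin d → ℝ} {ℱ : Filtration ℕ mΩ}
  {H : Ω → Trajectory K d n}

lemma OnlineModel.measurable_played (hon : OnlineModel μ c θ ℱ H) {t : ℕ} (ht : t < c.T) :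
    Measurable[ℱ t] fun ω => (H ω).played t := by
  have e : (fun ω => (H ω).played t) =
      fun ω => ∑ a, if (H ω).act t = a then (H ω).x t a else 0 := by
    funext ω
    simp [Trajectory.played]
  rw [e]
  refine Finset.measurable_sum _ fun a _ => Measurable.ite ?_ (hon.x_meas t ht a) measurable_const
  exact hon.act_meas t ht (measurableSet_singleton a)

variable [IsProbabilityMeasure μ]

/-- Features outside the layer are replaced by zero, so that a layer becomes a process indexed by
all rounds. It stays predictable, since the layer of a round is known before its reward. -/
lemma Trajectory.A_eq_sum_ite (h : Trajectory K d n) (t l : ℕ) :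
    h.A t l = ∑ s ∈ Finset.range t, vecMulVec (if h.layer s = l then h.played s else 0)
      (if h.layer s = l then h.played s else 0) := by
  rw [Trajectory.A, Trajectory.hist, Finset.sum_filter]
  refine Finset.sum_congr rfl fun s _ => ?_
  split_ifs <;> simp

lemma Trajectory.b_sub_eq_sum_ite (h : Trajectory K d n) (t l : ℕ) (θ : Fin d → ℝ) :
    h.b t l - h.A t l *ᵥ θ = ∑ s ∈ Finset.range t,
      (h.r s - h.played s ⬝ᵥ θ) • (if h.layer s = l then h.played s else 0) := by
  rw [Trajectory.A, Trajectory.b, sum_mulVec, ← Finset.sum_sub_distrib, Trajectory.hist,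
    Finset.sum_filter]
  refine Finset.sum_congr rfl fun s _ => ?_
  split_ifs
  · rw [vecMulVec_self_mulVec, sub_smul]
  · simp

/-- Self-normalized tail bound for the noise of one layer, with an `ℱ 0`-measurable prior
precision. -/
lemma OnlineModel.measure_layer_noise_gt_le (hon : OnlineModel μ c θ ℱ H) (hσ : 0 ≤ c.σ)
    {P : Ω → Matrix (Fin d) (Fin d) ℝ} (hP : ∀ ω, (P ω).PosDef)
    (hPm : ∀ i j, Measurable[ℱ 0] fun ω => P ω i j) {t : ℕ} (ht : t < c.T) (l : ℕ) {δ : ℝ}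
    (hδ : 0 < δ) :
    μ {ω | ¬ mnorm (P ω + (H ω).A t l)⁻¹ ((H ω).b t l - (H ω).A t l *ᵥ θ) ≤
      c.σ * √(2 * Real.log (√(P ω + (H ω).A t l).det / (√(P ω).det * δ)))}
        ≤ ENNReal.ofReal δ := by
  simp_rw [Trajectory.b_sub_eq_sum_ite, Trajectory.A_eq_sum_ite]
  have hpl : ∀ t < c.T, ∀ s ≤ t, Measurable[ℱ t] fun ω => (H ω).played s := fun t ht s hs =>
    (hon.measurable_played (by omega)).mono (ℱ.mono hs) le_rfl
  refine measure_mnorm_gt_le (μ := μ) (P := P)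
    (φ := fun s ω => if (H ω).layer s = l then (H ω).played s else 0)
    (η := fun s ω => (H ω).r s - (H ω).played s ⬝ᵥ θ) (m := fun s => ℱ s) (N := t) hσ hδ
    (fun s _ => ℱ.le s) hP (fun i j => (hPm i j).mono (ℱ.le 0) le_rfl)
    (fun s _ i j => (hPm i j).mono (ℱ.mono s.zero_le) le_rfl) ?_ ?_ ?_ ?_
  · intro t' ht' s hs
    have hlm : Measurable[ℱ t'] fun ω => (H ω).layer s :=
      (hon.layer_meas s (by omega)).mono (ℱ.mono hs) le_rfl
    exact Measurable.ite (hlm (measurableSet_singleton l)) (hpl t' (by omega) s hs)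
      measurable_const
  · intro t' ht' s hs
    exact (hon.r_past t' (by omega) s hs).sub
      (measurable_dotProduct (hpl t' (by omega) s hs.le) measurable_const)
  · intro s hs
    exact (hon.r_meas s (by omega)).sub (measurable_dotProduct
      ((hon.measurable_played (by omega)).mono (ℱ.le s) le_rfl) measurable_const)
  · exact fun s hs => (hon.noise s (by omega)).2

lemma OnlineModel.measure_online_failure_le (hon : OnlineModel μ c θ ℱ H) (hc : c.Admissible)
    {t l : ℕ} (ht : t < c.T) (hl : l ≤ c.L) :
    μ {ω | ¬ mnorm ((H ω).V t l)⁻¹ ((H ω).b t l - (H ω).A t l *ᵥ θ) ≤ (H ω).betaOn c t l - c.S}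
      ≤ ENNReal.ofReal (c.δonline t l) := by
  have key := hon.measure_layer_noise_gt_le hc.σ_nonneg (P := fun _ => 1)
    (fun _ => PosDef.one) (fun _ _ => measurable_const) ht l (hc.δonline_pos t ht l hl)
  simpa [Trajectory.betaOn, Trajectory.V] using key

lemma OnlineModel.measure_pool_failure_le (hon : OnlineModel μ c θ ℱ H) (hc : c.Admissible)
    {t l : ℕ} (ht : t < c.T) (hl : l ≤ c.L) :
    μ {ω | ¬ mnorm ((H ω).A t l + (H ω).Goff)⁻¹ ((H ω).b t l - (H ω).A t l *ᵥ θ) ≤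
      (H ω).gammaPool c t l} ≤ ENNReal.ofReal (c.δpool t l) := by
  -- `G` depends only on the offline covariates, so it is an admissible random prior; the offline
  -- responses play no role in this bound.
  have hGm : ∀ i j, Measurable[ℱ 0] fun ω => (H ω).Goff i j := by
    intro i j
    simp only [Trajectory.Goff, Matrix.add_apply, Matrix.sum_apply, vecMulVec_apply]
    refine measurable_const.add (Finset.measurable_sum _ fun k _ => ?_)
    exact ((measurable_pi_apply i).comp (hon.z_meas k)).mul
      ((measurable_pi_apply j).comp (hon.z_meas k))
  have key := hon.measure_layer_noise_gt_le hc.σ_nonneg (P := fun ω => (H ω).Goff)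
    (fun ω => (H ω).posDef_Goff) hGm ht l (hc.δpool_pos t ht l hl)
  simp_rw [add_comm (Trajectory.Goff _)] at key
  exact key

end Online

/-- The simultaneous confidence event has probability at least `1 - T⁻²`. -/
lemma one_sub_le_measureReal_good {K d n : ℕ} {Ω : Type*} {mΩ : MeasurableSpace Ω}
    {μ : Measure Ω} [IsProbabilityMeasure μ] {c : Config d} (hc : c.Admissible)
    {θ θd : Fin d → ℝ} {ℱ : Filtration ℕ mΩ} {H : Ω → Trajectory K d n}
    (hon : OnlineModel μ c θ ℱ H) (hoff : OfflineModel μ c θd H) :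
    1 - 1 / (c.T : ℝ) ^ 2 ≤ μ.real {ω | (H ω).Good c θ θd} := by
  set good := {ω | (H ω).Good c θ θd} with hgood
  set B₀ := {ω | ¬ mnorm (H ω).Goff ((H ω).thetaOff - θd) ≤ (H ω).betaOff c} with hB₀
  set B₁ : ℕ → ℕ → Set Ω := fun t l =>
    {ω | ¬ mnorm ((H ω).V t l)⁻¹ ((H ω).b t l - (H ω).A t l *ᵥ θ) ≤ (H ω).betaOn c t l - c.S}
    with hB₁
  set B₂ : ℕ → ℕ → Set Ω := fun t l =>
    {ω | ¬ mnorm ((H ω).A t l + (H ω).Goff)⁻¹ ((H ω).b t l - (H ω).A t l *ᵥ θ) ≤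
      (H ω).gammaPool c t l} with hB₂
  set R := Finset.range c.T ×ˢ Finset.range (c.L + 1) with hR
  have hmem : ∀ p ∈ R, p.1 < c.T ∧ p.2 ≤ c.L := fun p hp => by
    rw [hR, Finset.mem_product, Finset.mem_range, Finset.mem_range] at hp
    exact ⟨hp.1, Nat.le_of_lt_succ hp.2⟩
  -- The whole space is covered by the good event and the failures, so subadditivity suffices and
  -- the good event need not be shown measurable.
  have hcover : (Set.univ : Set Ω) ⊆
      good ∪ (B₀ ∪ ((⋃ p ∈ R, B₁ p.1 p.2) ∪ ⋃ p ∈ R, B₂ p.1 p.2)) := by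
    intro ω _
    by_contra hω
    simp only [Set.mem_union, Set.mem_iUnion, not_or, not_exists] at hω
    obtain ⟨h0, h1, h2, h3⟩ := hω
    refine h0 ⟨not_not.1 h1, fun t ht l hl => ?_⟩
    have hp : (t, l) ∈ R := by
      rw [hR, Finset.mem_product, Finset.mem_range, Finset.mem_range]
      exact ⟨ht, Nat.lt_succ_of_le hl⟩
    exact ⟨not_not.1 (h2 (t, l) hp), not_not.1 (h3 (t, l) hp)⟩
  have hsum : ∀ (δ : ℕ → ℕ → ℝ), (∀ t < c.T, ∀ l ≤ c.L, 0 < δ t l) → ∀ B : ℕ → ℕ → Set Ω,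
      (∀ t < c.T, ∀ l ≤ c.L, μ (B t l) ≤ ENNReal.ofReal (δ t l)) →
      μ.real (⋃ p ∈ R, B p.1 p.2) ≤
        ∑ t ∈ Finset.range c.T, ∑ l ∈ Finset.range (c.L + 1), δ t l := by
    intro δ hδ B hB
    rw [← Finset.sum_product']
    refine (measureReal_biUnion_finset_le R _).trans (Finset.sum_le_sum fun p hp => ?_)
    obtain ⟨h1, h2⟩ := hmem p hp
    exact ENNReal.toReal_le_of_le_ofReal (hδ _ h1 _ h2).le (hB _ h1 _ h2)
  have s1 := hsum c.δonline hc.δonline_pos B₁ fun t ht l hl =>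
    hon.measure_online_failure_le hc ht hl
  have s2 := hsum c.δpool hc.δpool_pos B₂ fun t ht l hl => hon.measure_pool_failure_le hc ht hl
  have s0 : μ.real B₀ ≤ c.δoff :=
    ENNReal.toReal_le_of_le_ofReal hc.δoff_pos.le (measure_offline_failure_le hc hoff)
  have h1 : 1 ≤ μ.real good + (μ.real B₀ + (μ.real (⋃ p ∈ R, B₁ p.1 p.2)
      + μ.real (⋃ p ∈ R, B₂ p.1 p.2))) := by
    calc (1 : ℝ) = μ.real Set.univ := probReal_univ.symm
      _ ≤ μ.real (good ∪ (B₀ ∪ ((⋃ p ∈ R, B₁ p.1 p.2) ∪ ⋃ p ∈ R, B₂ p.1 p.2))) :=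
          measureReal_mono hcover
      _ ≤ _ := (measureReal_union_le _ _).trans <| add_le_add le_rfl <|
          (measureReal_union_le _ _).trans <| add_le_add le_rfl (measureReal_union_le _ _)
  linarith [hc.sum_all, hc.sum_online]

end EllipsoidalMinUCB

theorem mainTheorem6 {K d n : ℕ} {Ω : Type*} [mΩ : MeasurableSpace Ω]
    (μ : Measure Ω) [IsProbabilityMeasure μ]
    (c : EllipsoidalMinUCB.Config d) (hc : c.Admissible)
    (θ θd : Fin d → ℝ) (hcert : c.ValidCertificate θ θd)
    (ℱ : Filtration ℕ mΩ) (H : Ω → EllipsoidalMinUCB.Trajectory K d n)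
    (hon : EllipsoidalMinUCB.OnlineModel μ c θ ℱ H)
    (hoff : EllipsoidalMinUCB.OfflineModel μ c θd H)
    (hrun : ∀ ω, (H ω).IsRun c) :
    1 - 1 / (c.T : ℝ) ^ 2 ≤ μ.real {ω | (H ω).Good c θ θd} ∧
    ∀ ω, (H ω).Good c θ θd →
      (H ω).regret c θ ≤ (H ω).pooledTerm c ∧
      (H ω).pooledTerm c ≤ (H ω).alignedPooledTerm c ∧
      (H ω).regret c θ ≤ (H ω).alignedPooledTerm c ∧
      ∀ C : ℝ, 0 ≤ C →
        (H ω).LamSum c *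
            ((H ω).GammaPool c + c.ρ * Real.sqrt ((H ω).cAlign c)) ^ 2 ≤
          C ^ 2 / 128 * d * c.logFactor K ^ 3 →
        (H ω).pooledTerm c ≤ EllipsoidalMinUCB.fallback C c K ∧
        (H ω).alignedPooledTerm c ≤ EllipsoidalMinUCB.fallback C c K := by
  refine ⟨EllipsoidalMinUCB.one_sub_le_measureReal_good hc hon hoff, fun ω hgood => ?_⟩
  have hreg := EllipsoidalMinUCB.Trajectory.regret_le_pooledTerm hc hcert hon.theta_le
    (fun t ht a => hon.x_le t ht a ω) (fun t ht a => hon.mean_mem t ht a ω) (hrun ω) hgood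
  have halign := EllipsoidalMinUCB.Trajectory.pooledTerm_le_alignedPooledTerm hcert.1 hcert.2.1
    (fun t ht => hon.x_le t ht _ ω) (fun t ht => (hrun ω t ht).1)
  refine ⟨hreg, halign, hreg.trans halign, fun C hC hregime => ?_⟩
  have hfall := EllipsoidalMinUCB.Trajectory.alignedPooledTerm_le_fallback (h := H ω) hc
    ((Real.sqrt_nonneg _).trans hon.theta_le) hcert.2.1 hC hregime
  exact ⟨halign.trans hfall, hfall⟩
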